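/- Let $A$ be a simplicial set. Call a map of simplicial sets a \emph{right fibration} (resp. a \emph{left fibration}) if it has the right lifting property with respect to the horn inclusions $\Lambda^n_k\to\Delta^n$ for all $n\ge 1$ and $0<k\le n$ (resp. $0\le k<n$). For objects $X,W$ of $\mathbf{sSet}/A$ let $[X,W]_A$ denote the quotient of the set of maps $X\to W$ over $A$ by the equivalence relation generated by homotopies $X\times\Delta^1\to W$ over $A$ (that is, the set of connected components of the simplicial set of maps $X\to W$ over $A$). \begin{enumerate} \item There exists a unique model structure on $\mathbf{sSet}/A$ whose cofibrations are the monomorphisms and whose fibrant objects are the right fibrations $X\to A$. It is Joyal's Contravariant model structure: a map $f\colon X\to Y$ over $A$ is a weak equivalence in it if and only if $f^*\colon [Y,W]_A\to[X,W]_A$ is bijective for every right fibration $W\to A$. \item Dually, there exists a unique model structure on $\mathbf{sSet}/A$ whose cofibrations are the monomorphisms and whose fibrant objects are the left fibrations $X\to A$. It is Joyal's Covariant model structure: a map $f\colon X\to Y$ over $A$ is a weak equivalence in it if and only if $f^*\colon [Y,W]_A\to[X,W]_A$ is bijective for every left fibration $W\to A$. \end{enumerate} -/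

import Mathlib

open CategoryTheory MonoidalCategory CartesianMonoidalCategory HomotopicalAlgebra Simplicial

universe u

namespace SSet

/-- The horn inclusions `Λ[n, k] ⟶ Δ[n]` with `n ≥ 1` and `0 < k ≤ n`. -/
inductive rightHornInclusions : MorphismProperty SSet.{u} where
  | intro {n : ℕ} (k : Fin (n + 2)) (hk : 0 < k) : rightHornInclusions Λ[n + 1, k].ι

/-- The horn inclusions `Λ[n, k] ⟶ Δ[n]` with `n ≥ 1` and `0 ≤ k < n`. -/
inductive leftHornInclusions : MorphismProperty SSet.{u} where
  | intro {n : ℕ} (k : Fin (n + 2)) (hk : k < Fin.last (n + 1)) :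
      leftHornInclusions Λ[n + 1, k].ι

/-- Right fibrations of simplicial sets. -/
def rightFibrations : MorphismProperty SSet.{u} := rightHornInclusions.rlp

/-- Left fibrations of simplicial sets. -/
def leftFibrations : MorphismProperty SSet.{u} := leftHornInclusions.rlp

variable {A : SSet.{u}}

/-- There is a homotopy `X × Δ[1] ⟶ W` over `A` from `f` to `g`, i.e. an edge from `f` to `g`
in the simplicial set of maps from `X` to `W` over `A`. -/
def HomotopicOver {X W : Over A} (f g : X ⟶ W) : Prop :=
  ∃ h : X.left ⊗ Δ[1] ⟶ W.left,
    ι₀ ≫ h = f.left ∧ ι₁ ≫ h = g.left ∧ h ≫ W.hom = fst X.left Δ[1] ≫ X.hom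

/-- The set of homotopy classes of maps `X ⟶ W` over `A`: the quotient by the equivalence relation
generated by homotopy over `A`, i.e. the set of connected components of the simplicial set of maps
from `X` to `W` over `A`. -/
def HomotopyClassesOver (X W : Over A) : Type u :=
  Quot (HomotopicOver (X := X) (W := W))

lemma HomotopicOver.precomp {X Y W : Over A} (p : X ⟶ Y) {f g : Y ⟶ W}
    (H : HomotopicOver f g) : HomotopicOver (p ≫ f) (p ≫ g) := by
  obtain ⟨h, h₀, h₁, hA⟩ := H
  refine ⟨p.left ▷ Δ[1] ≫ h, ?_, ?_, ?_⟩
  · exact (ι₀_comp_assoc p.left h).trans (by rw [h₀, Over.comp_left])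
  · exact (ι₁_comp_assoc p.left h).trans (by rw [h₁, Over.comp_left])
  · rw [Category.assoc, hA, whiskerRight_fst_assoc, Over.w]

/-- The map `[Y, W] → [X, W]` induced by `f : X ⟶ Y`. -/
def HomotopyClassesOver.precomp {X Y : Over A} (f : X ⟶ Y) (W : Over A) :
    HomotopyClassesOver Y W → HomotopyClassesOver X W :=
  Quot.map (fun g ↦ f ≫ g) (fun _ _ H ↦ H.precomp f)

/-- Joyal's contravariant equivalences over `A`: the maps `f : X ⟶ Y` over `A` which induce a
bijection `[Y, W] → [X, W]` for every right fibration `W ⟶ A`. -/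
def IsContravariantEquivalence {X Y : Over A} (f : X ⟶ Y) : Prop :=
  ∀ W : Over A, rightFibrations W.hom → Function.Bijective (HomotopyClassesOver.precomp f W)

/-- Joyal's covariant equivalences over `A`: the maps `f : X ⟶ Y` over `A` which induce a
bijection `[Y, W] → [X, W]` for every left fibration `W ⟶ A`. -/
def IsCovariantEquivalence {X Y : Over A} (f : X ⟶ Y) : Prop :=
  ∀ W : Over A, leftFibrations W.hom → Function.Bijective (HomotopyClassesOver.precomp f W)

/-- The model structure `M` on `sSet/A` has the monomorphisms as its cofibrations, and an
object `X ⟶ A` is fibrant in it if and only if `X ⟶ A` belongs to the class `P`. -/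
structure HasMonoCofibrationsAndFibrantObjects (A : SSet.{u}) (P : MorphismProperty SSet.{u})
    (M : ModelCategory (Over A)) : Prop where
  cofibration_iff : ∀ {X Y : Over A} (i : X ⟶ Y), Cofibration i ↔ Mono i.left
  isFibrant_iff : ∀ X : Over A, IsFibrant X ↔ P X.hom

end SSet

-- Let `J` be the relevant class of horns and let `i₁` be the end of `X × Δ[1]` at the vertex `e`
-- for which `Λ[1, e]` belongs to `J` (vertex 1 for right fibrations, 0 for left ones). The
-- combinatorial input is that the pushout-product of a horn in `J` with a boundary inclusion lies
-- in the saturation of `J`; by adjunction the same holds with any monomorphism. Hence homotopies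
-- lift along `J`-fibrations relative to a subobject and to the end `i₁`, and homotopies between
-- given maps into a `J`-injective object extend along `J`. These facts pass to the slice over `A`
-- and are recorded in `IsAnodyne`.
--
-- The rest of the existence proof is formal and follows Cisinski. Homotopy is an equivalence
-- relation on maps into `J`-injective objects; weak equivalences are tested on homotopy classes; a
-- `J`-fibration between injective objects which is a weak equivalence lifts against all
-- monomorphisms (`monomorphisms_rlp_of_weakEquivalences`); and monic weak equivalences lift against
-- `J`-fibrations with injective codomain (`le_naiveFibrations_llp`).
--
-- What remains is a small set generating the trivial cofibrations, as in Smith's theorem. Weak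
-- equivalences are detected after an injective envelope functor commuting with filtered colimits,
-- and between injective objects they are the maps with a homotopy lifting property against the
-- boundary inclusions. They are therefore the arrows at which certain maps between finitely
-- accessible functors are surjective, and a cardinality argument
-- (`exists_essentiallySmall_factorization`) gives a small solution set. Since `J`-fibrations with
-- injective codomain lift against the resulting generators, the fibrant objects are exactly the
-- `J`-injective ones.
--
-- For uniqueness, when all objects are cofibrant a map is a weak equivalence iff it is bijective on
-- homotopy classes of maps to fibrant objects. These homotopies can be tested on precylinders whose
-- projection lifts against the cofibrations, so cofibrations and fibrant objects determine the
-- whole structure.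

universe v

/-! ### Solution sets for surjectivity conditions between accessible functors -/

namespace CategoryTheory

open Limits Opposite

attribute [local instance] Cardinal.fact_isRegular_aleph0

lemma ObjectProperty.exists_regular_cardinal_le_isCardinalPresentable
    {C : Type v} [Category.{u} C] [IsAccessibleCategory.{u} C]
    (P : ObjectProperty C) [ObjectProperty.Small.{u} P] {ι : Type*} [Small.{u} ι]
    (X : ι → Type u) :
    ∃ (κ : Cardinal.{u}) (_ : Fact κ.IsRegular), P ≤ isCardinalPresentable C κ ∧
      ∀ i, HasCardinalLT (X i) κ := by
  have hP (s : Subtype P) : ∃ (κ : Cardinal.{u}) (_ : Fact κ.IsRegular),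
      IsCardinalPresentable s.1 κ :=
    Functor.IsAccessible.exists_cardinal
  choose κ₀ hκ₀ hκ₀' using hP
  obtain ⟨κ, hκ, h⟩ := HasCardinalLT.exists_regular_cardinal_forall.{u}
    (Sum.elim X (fun s : Subtype P ↦ (κ₀ s).ord.ToType))
  have : Fact κ.IsRegular := ⟨hκ⟩
  refine ⟨κ, this, fun s hs ↦ ?_, fun i ↦ h (Sum.inl i)⟩
  have hs' : κ₀ ⟨s, hs⟩ ≤ κ :=
    le_of_lt (by simpa [hasCardinalLT_iff_cardinal_mk_lt] using h (Sum.inr ⟨s, hs⟩))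
  rw [isCardinalPresentable_iff]
  have := hκ₀' ⟨s, hs⟩
  exact isCardinalPresentable_of_le s hs'

lemma ObjectProperty.essentiallySmall_colimitsOfShape {C : Type v} [Category.{u} C]
    (P : ObjectProperty C) [ObjectProperty.EssentiallySmall.{u} P]
    (J : Type) [SmallCategory J] :
    ObjectProperty.EssentiallySmall.{u} (P.colimitsOfShape J) where
  exists_small_le' := by
    obtain ⟨Q, _, hQ⟩ := ObjectProperty.EssentiallySmall.exists_small_le'.{u} P
    refine ⟨Q.strictColimitsOfShape J, inferInstance, ?_⟩
    rw [isoClosure_strictColimitsOfShape, ← colimitsOfShape_isoClosure J (P := Q)]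
    exact colimitsOfShape_monotone J hQ

section

variable {C : Type v} [Category.{u} C] {ι : Type u} {Prob Sol : ι → C ⥤ Type u}
  (res : ∀ i, Sol i ⟶ Prob i)

/-- The objects at which all the natural transformations `res i` are surjective. -/
def surjectivityProperty : ObjectProperty C :=
  fun X ↦ ∀ i, Function.Surjective ((res i).app X)

variable [IsLocallyFinitelyPresentable.{u} C]
  [∀ i, Functor.IsFinitelyAccessible.{u} (Prob i)]
  [∀ i, Functor.IsFinitelyAccessible.{u} (Sol i)]

/-- One round of solving. Every problem on `s` has a solution in `p`. Writing `p` as a sufficiently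
filtered colimit of presentable objects, each solution already exists at some stage, and a single
stage serves all problems on `s`. -/
lemma exists_essentiallySmall_solving (P : ObjectProperty C)
    [ObjectProperty.EssentiallySmall.{u} P] :
    ∃ (P' : ObjectProperty C) (_ : ObjectProperty.EssentiallySmall.{u} P'),
      ∀ ⦃s p : C⦄ (g : s ⟶ p), P s → surjectivityProperty res p →
        ∃ (s' : C) (a : s ⟶ s') (b : s' ⟶ p), P' s' ∧ a ≫ b = g ∧
          ∀ (i : ι) (x : (Prob i).obj s), ∃ y : (Sol i).obj s',
            (res i).app s' y = (Prob i).map a x := by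
  obtain ⟨P₀, _, hP₀, hP₀'⟩ := ObjectProperty.EssentiallySmall.exists_small_le.{u} P
  have : IsLocallyPresentable.{u} C := ⟨_, inferInstance, ‹_›⟩
  -- `κ` bounds the presentability of each `s`, so that `s ⟶ p` factors through a stage, and also
  -- the total number of problems on `s`, so that the stages solving them have a common upper bound.
  obtain ⟨κ, hκ, h₁, h₂⟩ := P₀.exists_regular_cardinal_le_isCardinalPresentable
    (fun s : Subtype P₀ ↦ Σ i, (Prob i).obj s.1)
  have hκ₀ : Cardinal.aleph0 ≤ κ := hκ.out.aleph0_le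
  have := IsCardinalLocallyPresentable.of_le C hκ₀
  refine ⟨isCardinalPresentable C κ, inferInstance, fun s p g hs hp ↦ ?_⟩
  obtain ⟨s₀, hs₀, ⟨e⟩⟩ := hP₀' _ hs
  obtain ⟨G, _, hG⟩ := HasCardinalFilteredGenerator.exists_generator C κ
  obtain ⟨J, _, _, ⟨c⟩⟩ := hG.exists_colimitsOfShape p
  have hκs : IsCardinalPresentable s κ := by
    have := (isCardinalPresentable_iff κ _).1 (h₁ _ hs₀)
    exact isCardinalPresentable_of_iso e.symm κ
  have hprob : HasCardinalLT (Σ i, (Prob i).obj s) κ :=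
    (h₂ ⟨s₀, hs₀⟩).of_injective (fun x ↦ ⟨x.1, (Prob x.1).map e.hom x.2⟩) (by
      rintro ⟨i, x⟩ ⟨j, y⟩ h
      obtain rfl : i = j := congr_arg Sigma.fst h
      have h' : (Prob i).map e.hom x = (Prob i).map e.hom y := by simpa using h
      have := congr_arg ((Prob i).map e.inv) h'
      simp only [← Functor.map_comp_apply, Iso.hom_inv_id, Functor.map_id_apply] at this
      rw [this])
  have := isFiltered_of_isCardinalFiltered J κ
  obtain ⟨j₀, f₀, hf₀⟩ := IsCardinalPresentable.exists_hom_of_isColimit κ c.isColimit g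
  have key (x : Σ i, (Prob i).obj s) : ∃ (j : J) (u : j₀ ⟶ j)
      (y : (Sol x.1).obj (c.diag.obj j)),
      (res x.1).app _ y = (Prob x.1).map (f₀ ≫ c.diag.map u) x.2 := by
    obtain ⟨i, x⟩ := x
    have : IsCardinalFiltered J Cardinal.aleph0.{u} := IsCardinalFiltered.of_le J hκ₀
    have := (Prob i).preservesColimitsOfShape_of_isCardinalAccessible Cardinal.aleph0.{u} J
    have := (Sol i).preservesColimitsOfShape_of_isCardinalAccessible Cardinal.aleph0.{u} J
    obtain ⟨y, hy⟩ := hp i ((Prob i).map g x)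
    have hc₁ := isColimitOfPreserves (Sol i) c.isColimit
    have hc₂ := isColimitOfPreserves (Prob i) c.isColimit
    obtain ⟨j₁, y₁, hy₁⟩ := Types.jointly_surjective_of_isColimit hc₁ y
    have : (Prob i).map (c.ι.app j₁) ((res i).app _ y₁) =
        (Prob i).map (c.ι.app j₀) ((Prob i).map f₀ x) := by
      dsimp at hy₁ hf₀
      rw [← NatTrans.naturality_apply, hy₁, ← Functor.map_comp_apply, hf₀]
      exact hy
    -- The candidate solves the problem only in the colimit; by filteredness it does so at a later
    -- stage.
    obtain ⟨k, u, v, huv⟩ := (Types.FilteredColimit.isColimit_eq_iff _ hc₂).1 this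
    refine ⟨k, v, (Sol i).map (c.diag.map u) y₁, ?_⟩
    dsimp at huv
    rw [NatTrans.naturality_apply, huv, ← Functor.map_comp_apply]
  choose j u y hy using key
  obtain ⟨k, a, b, hab⟩ := IsCardinalFiltered.wideSpan u hprob
  refine ⟨c.diag.obj k, f₀ ≫ c.diag.map b, c.ι.app k, hG.le_isCardinalPresentable _
    (c.prop_diag_obj k), by simp [hf₀], fun i x ↦ ⟨(Sol i).map (c.diag.map (a ⟨i, x⟩))
      (y ⟨i, x⟩), ?_⟩⟩
  rw [NatTrans.naturality_apply, hy ⟨i, x⟩, ← Functor.map_comp_apply, ← hab ⟨i, x⟩,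
    Category.assoc, ← Functor.map_comp]

/-- Iterate the previous lemma countably often. A problem on the colimit of the sequence comes from
a finite stage, because the functors commute with filtered colimits, and it is solved at the next
stage. -/
lemma exists_essentiallySmall_factorization (P : ObjectProperty C)
    [ObjectProperty.EssentiallySmall.{u} P] :
    ∃ (S : ObjectProperty C) (_ : ObjectProperty.EssentiallySmall.{u} S),
      S ≤ surjectivityProperty res ∧
      ∀ ⦃s p : C⦄ (g : s ⟶ p), P s → surjectivityProperty res p →
        ∃ (s' : C) (a : s ⟶ s') (b : s' ⟶ p), S s' ∧ a ≫ b = g := by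
  choose next hnext hnext' using fun (P : ObjectProperty C)
    (_ : ObjectProperty.EssentiallySmall.{u} P) ↦ exists_essentiallySmall_solving res P
  let chain (n : ℕ) : { P : ObjectProperty C // ObjectProperty.EssentiallySmall.{u} P } :=
    n.rec ⟨P, inferInstance⟩ (fun _ P' ↦ ⟨next P'.1 P'.2, hnext P'.1 P'.2⟩)
  have (n : ℕ) : ObjectProperty.EssentiallySmall.{u} (chain n).1 := (chain n).2
  have : ObjectProperty.EssentiallySmall.{u} ((⨆ n, (chain n).1).colimitsOfShape ℕ) :=
    ObjectProperty.essentiallySmall_colimitsOfShape _ _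
  refine ⟨(⨆ n, (chain n).1).colimitsOfShape ℕ ⊓ surjectivityProperty res,
    ObjectProperty.EssentiallySmall.of_le.{u} inf_le_left, inf_le_right,
    fun s p g hs hp ↦ ?_⟩
  choose! nextObj nextMap nextDesc h₁ h₂ h₃ using
    fun (n : ℕ) (s : { s : Over p // (chain n).1 s.left }) ↦
      hnext' (chain n).1 (chain n).2 s.1.hom s.2 hp
  let T (n : ℕ) := { s : Over p // (chain n).1 s.left }
  let seq (n : ℕ) : T n :=
    n.rec (motive := T) ⟨Over.mk g, hs⟩ (fun n t ↦ ⟨Over.mk (nextDesc n t), h₁ n t⟩)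
  let F : ℕ ⥤ C := Functor.ofSequence (X := fun n ↦ (seq n).1.left) (fun n ↦ nextMap n (seq n))
  have hF (n : ℕ) : F.map (homOfLE (Nat.le_succ n)) = nextMap n (seq n) :=
    Functor.ofSequence_map_homOfLE_succ _ _
  let c : Cocone F :=
    { pt := p
      ι := NatTrans.ofSequence (fun n ↦ (seq n).1.hom) (fun n ↦ by
        rw [hF]
        exact (h₂ n (seq n)).trans (Category.comp_id _).symm) }
  refine ⟨colimit F, colimit.ι F 0, colimit.desc F c, ⟨⟨.colimit F, fun n ↦ ?_⟩, ?_⟩, ?_⟩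
  · exact le_iSup (fun n ↦ (chain n).1) n _ (seq n).2
  · intro i x
    have h₄ (F' : C ⥤ Type u) [Functor.IsFinitelyAccessible.{u} F'] :
        PreservesColimitsOfShape ℕ F' := by
      have : IsCardinalFiltered ℕ Cardinal.aleph0.{u} := by
        rw [isCardinalFiltered_aleph0_iff]
        infer_instance
      exact F'.preservesColimitsOfShape_of_isCardinalAccessible_of_essentiallySmall
        Cardinal.aleph0.{u} ℕ
    have := h₄ (Prob i)
    obtain ⟨n, x, rfl⟩ := Types.jointly_surjective_of_isColimit
      (isColimitOfPreserves (Prob i) (colimit.isColimit F)) x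
    obtain ⟨y, hy⟩ : ∃ y : (Sol i).obj (F.obj (n + 1)), (res i).app (F.obj (n + 1)) y =
        (Prob i).map (F.map (homOfLE (Nat.le_succ n))) x := by
      rw [hF]
      exact h₃ n (seq n) i x
    refine ⟨(Sol i).map (colimit.ι F (n + 1)) y, ?_⟩
    rw [NatTrans.naturality_apply, hy, ← Functor.map_comp_apply, colimit.w]
    rfl
  · exact colimit.ι_desc c 0

end

end CategoryTheory

/-! ### A small object argument that commutes with filtered colimits -/

namespace CategoryTheory

open Limits Opposite

attribute [local instance] Cardinal.fact_isRegular_aleph0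

lemma Functor.isCardinalAccessible_colimit {C D K : Type*} [Category* C] [Category* D]
    [Category* K] [HasColimitsOfShape K D] (F : K ⥤ C ⥤ D) (κ : Cardinal.{u}) [Fact κ.IsRegular]
    [∀ k, (F.obj k).IsCardinalAccessible κ] :
    (colimit F).IsCardinalAccessible κ where
  preservesColimitOfShape J _ _ := by
    have (k : K) := (F.obj k).preservesColimitsOfShape_of_isCardinalAccessible κ J
    have : PreservesColimitsOfShape J F.flip :=
      preservesColimitsOfShape_of_evaluation _ _ (fun k ↦
        inferInstanceAs (PreservesColimitsOfShape J (F.obj k)))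
    exact preservesColimitsOfShape_of_natIso (colimitIsoFlipCompColim F).symm

namespace InjectiveEnvelope

variable {C : Type v} [Category.{u} C] [HasColimitsOfSize.{u, u} C] {ι : Type u}
  {a b : ι → C} (j : ∀ i, a i ⟶ b i)

variable (a) in
/-- The functor sending `X` to the coproduct of copies of `b i` indexed by all
the morphisms `a i ⟶ X`. -/
noncomputable abbrev cells (b : ι → C) : C ⥤ C :=
  ∐ fun i ↦ coyoneda.obj (op (a i)) ⋙ sigmaConst.{u}.obj (b i)

/-- The coproduct of all the copies of the given morphisms `a i ⟶ b i`. -/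
noncomputable abbrev cellsMap : cells a a ⟶ cells a b :=
  Limits.Sigma.map fun i ↦ Functor.whiskerLeft _ (sigmaConst.{u}.map (j i))

variable (a) in
/-- The tautological attaching map. -/
noncomputable abbrev cellsDesc : cells a a ⟶ 𝟭 C :=
  Limits.Sigma.desc fun i ↦ (sigmaConstAdj (a i)).counit

/-- The functor which attaches a copy of `b i` to `X` for any morphism `a i ⟶ X`. -/
noncomputable abbrev step : C ⥤ C := pushout (cellsDesc a) (cellsMap j)

/-- The inclusion of an object in the result of attaching cells. -/
noncomputable abbrev toStep : 𝟭 C ⟶ step j := pushout.inl _ _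

/-- Colimits of functors are computed pointwise, so at `X` this map is a pushout of a coproduct of
copies of the `j i`. -/
lemma toStep_mem (X : C) : (MorphismProperty.ofHoms j).rlp.llp ((toStep j).app X) := by
  have sq : IsPushout ((cellsDesc a).app X) ((cellsMap j).app X) ((toStep j).app X)
    ((pushout.inr (cellsDesc a) (cellsMap j)).app X) :=
    (IsPushout.of_hasPushout (cellsDesc a) (cellsMap j)).map ((evaluation _ _).obj X)
  refine MorphismProperty.of_isPushout sq ?_
  refine MorphismProperty.colimitsOfShape_le (J := Discrete ι) _
    (MorphismProperty.colimitsOfShape.mk' _ _ _ _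
    (isColimitOfPreserves ((evaluation _ _).obj X) (coproductIsCoproduct
      (fun i ↦ coyoneda.obj (op (a i)) ⋙ sigmaConst.{u}.obj (a i))))
    (isColimitOfPreserves ((evaluation _ _).obj X) (coproductIsCoproduct
      (fun i ↦ coyoneda.obj (op (a i)) ⋙ sigmaConst.{u}.obj (b i))))
    (Discrete.natTrans fun ⟨i⟩ ↦ (sigmaConst.{u}.map (j i)).app _) ?_ _ ?_)
  · rintro ⟨i⟩
    refine MorphismProperty.colimMap (J := Discrete (a i ⟶ X)) _ ?_
    rintro ⟨f⟩
    exact MorphismProperty.le_llp_rlp _ _ ⟨i⟩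
  · rintro ⟨i⟩
    have := Limits.Sigma.ι_map (fun i ↦ Functor.whiskerLeft (coyoneda.obj (op (a i)))
      (sigmaConst.{u}.map (j i))) i
    exact NatTrans.congr_app this X

lemma exists_extension_toStep {X : C} (i : ι) (f : a i ⟶ X) :
    ∃ g : b i ⟶ (step j).obj X, j i ≫ g = f ≫ (toStep j).app X := by
  refine ⟨Limits.Sigma.ι (fun _ : a i ⟶ X ↦ b i) f ≫
    (Limits.Sigma.ι (fun i ↦ coyoneda.obj (op (a i)) ⋙ sigmaConst.{u}.obj (b i)) i).app X ≫
    (pushout.inr (cellsDesc a) (cellsMap j)).app X, ?_⟩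
  have h₁ := NatTrans.congr_app (pushout.condition (f := cellsDesc a) (g := cellsMap j)) X
  have h₂ := NatTrans.congr_app (Limits.Sigma.ι_map (fun i ↦ Functor.whiskerLeft (coyoneda.obj (op (a i)))
      (sigmaConst.{u}.map (j i))) i) X
  have h₃ := NatTrans.congr_app (Limits.Sigma.ι_desc (fun i ↦ (sigmaConstAdj (a i)).counit) i) X
  have h₄ : Limits.Sigma.ι (fun _ : a i ⟶ X ↦ a i) f ≫ (sigmaConstAdj (a i)).counit.app X = f := by
    simp [sigmaConstAdj]
  have h₅ : Limits.Sigma.ι (fun _ : a i ⟶ X ↦ a i) f ≫ (sigmaConst.{u}.map (j i)).app (a i ⟶ X) =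
    j i ≫ Limits.Sigma.ι (fun _ : a i ⟶ X ↦ b i) f := by simp
  dsimp at h₁ h₂ h₃ h₄ h₅ ⊢
  rw [← reassoc_of% h₅, ← reassoc_of% h₂, ← h₁, reassoc_of% h₃, reassoc_of% h₄]

/-- Cells are attached along all maps, so the construction is a colimit of functors of the form
`Hom(a i, -)` followed by a copower. Only the first factor needs a finiteness condition; no
condition on `b i` is used. -/
instance [∀ i, IsFinitelyPresentable.{u} (a i)] : Functor.IsFinitelyAccessible.{u} (step j) := by
  have h (b : ι → C) : Functor.IsFinitelyAccessible.{u} (cells a b) := by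
    have : ∀ (k : Discrete ι), Functor.IsFinitelyAccessible.{u} ((Discrete.functor fun i ↦
        coyoneda.obj (op (a i)) ⋙ sigmaConst.{u}.obj (b i)).obj k) := by
      rintro ⟨i⟩
      dsimp
      infer_instance
    exact Functor.isCardinalAccessible_colimit _ _
  have : ∀ k, Functor.IsFinitelyAccessible.{u} ((span (cellsDesc a) (cellsMap j)).obj k) := by
    rintro (_ | _ | _)
    · exact h a
    · exact inferInstanceAs (Functor.IsFinitelyAccessible.{u} (𝟭 C))
    · exact h b
  exact Functor.isCardinalAccessible_colimit _ _

/-- The iterations of the functor which attaches cells. -/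
noncomputable def iter (n : ℕ) : C ⥤ C := n.rec (𝟭 C) (fun _ F ↦ F ⋙ step j)

/-- The transition maps in the sequence of iterations. -/
noncomputable def iterMap (n : ℕ) : iter j n ⟶ iter j (n + 1) :=
  Functor.whiskerLeft (iter j n) (toStep j)

instance [∀ i, IsFinitelyPresentable.{u} (a i)] (n : ℕ) :
    Functor.IsFinitelyAccessible.{u} (iter j n) := by
  induction n with
  | zero => dsimp [iter]; infer_instance
  | succ n hn => exact inferInstanceAs (Functor.IsFinitelyAccessible.{u} (iter j n ⋙ step j))

/-- The injective envelope functor for a family of morphisms. -/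
noncomputable def functor : C ⥤ C := colimit (Functor.ofSequence (iterMap j))

instance [∀ i, IsFinitelyPresentable.{u} (a i)] :
    Functor.IsFinitelyAccessible.{u} (functor j) := by
  have : ∀ n, Functor.IsFinitelyAccessible.{u} ((Functor.ofSequence (iterMap j)).obj n) :=
    fun n ↦ inferInstanceAs (Functor.IsFinitelyAccessible.{u} (iter j n))
  exact Functor.isCardinalAccessible_colimit _ _

/-- The inclusion of an object in its injective envelope. -/
noncomputable def unit : 𝟭 C ⟶ functor j := colimit.ι (Functor.ofSequence (iterMap j)) 0

/-- The map from an iteration to the injective envelope functor. -/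
noncomputable def ofIter (n : ℕ) : iter j n ⟶ functor j :=
  colimit.ι (Functor.ofSequence (iterMap j)) n

lemma iterMap_ofIter (n : ℕ) : iterMap j n ≫ ofIter j (n + 1) = ofIter j n := by
  have h := colimit.w (Functor.ofSequence (iterMap j)) (homOfLE (Nat.le_succ n))
  rwa [Functor.ofSequence_map_homOfLE_succ] at h

/-- The evaluation of the colimit cocone defining the injective envelope functor. -/
noncomputable def isColimit (X : C) :
    IsColimit (((evaluation _ _).obj X).mapCocone
      (colimit.cocone (Functor.ofSequence (iterMap j)))) :=
  isColimitOfPreserves _ (colimit.isColimit _)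

lemma unit_mem (X : C) : (MorphismProperty.ofHoms j).rlp.llp ((unit j).app X) := by
  let W := (MorphismProperty.ofHoms j).rlp.llp
  refine MorphismProperty.transfiniteCompositionsOfShape_le W ℕ _ ⟨?_⟩
  exact
   { F := Functor.ofSequence (iterMap j) ⋙ (evaluation _ _).obj X
     isoBot := Iso.refl _
     incl := (((evaluation _ _).obj X).mapCocone
      (colimit.cocone (Functor.ofSequence (iterMap j)))).ι
     isColimit := isColimit j X
     fac := Category.id_comp _
     map_mem n _ := by
      have := Functor.ofSequence_map_homOfLE_succ (iterMap j) n
      have h : W (((evaluation _ _).obj X).map (iterMap j n)) := toStep_mem j ((iter j n).obj X)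
      rw [← this] at h
      exact h }

/-- As `a i` is finitely presentable, a map from it to the colimit factors through a finite
iteration, and it extends at the following one; countably many steps suffice. -/
lemma exists_extension [∀ i, IsFinitelyPresentable.{u} (a i)] {X : C} (i : ι)
    (f : a i ⟶ (functor j).obj X) :
    ∃ g : b i ⟶ (functor j).obj X, j i ≫ g = f := by
  have : IsCardinalFiltered ℕ Cardinal.aleph0.{u} := by
    rw [isCardinalFiltered_aleph0_iff]
    infer_instance
  obtain ⟨n, f, rfl⟩ := IsCardinalPresentable.exists_hom_of_isColimit Cardinal.aleph0.{u}
    (isColimit j X) f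
  obtain ⟨g, hg⟩ := exists_extension_toStep j i (X := (iter j n).obj X) f
  refine ⟨g ≫ ((ofIter j (n + 1)).app X :), ?_⟩
  refine ((Category.assoc _ _ _).symm.trans (hg =≫ _)).trans ((Category.assoc _ _ _).trans ?_)
  exact congr_arg (f ≫ ·) (NatTrans.congr_app (iterMap_ofIter j n) X)

end InjectiveEnvelope

end CategoryTheory

/-! ### Homotopy theory of injective objects relative to a cylinder -/

set_option linter.unusedSectionVars false

namespace CategoryTheory

open Limits Opposite

/-- A functorial cylinder in a category. -/
structure HomotopyCylinder (D : Type v) [Category.{u} D] [HasBinaryCoproducts D] where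
  /-- the cylinder functor -/
  cyl : D ⥤ D
  /-- the first end of the cylinder -/
  i₀ (X : D) : X ⟶ cyl.obj X
  /-- the second end of the cylinder -/
  i₁ (X : D) : X ⟶ cyl.obj X
  /-- the projection -/
  pr (X : D) : cyl.obj X ⟶ X
  i₀_naturality {X Y : D} (f : X ⟶ Y) : i₀ X ≫ cyl.map f = f ≫ i₀ Y := by cat_disch
  i₁_naturality {X Y : D} (f : X ⟶ Y) : i₁ X ≫ cyl.map f = f ≫ i₁ Y := by cat_disch
  pr_naturality {X Y : D} (f : X ⟶ Y) : cyl.map f ≫ pr Y = pr X ≫ f := by cat_disch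
  i₀_pr (X : D) : i₀ X ≫ pr X = 𝟙 X := by cat_disch
  i₁_pr (X : D) : i₁ X ≫ pr X = 𝟙 X := by cat_disch
  mono_i (X : D) : Mono (coprod.desc (i₀ X) (i₁ X))

namespace HomotopyCylinder

attribute [simp] i₀_pr i₁_pr
attribute [instance] mono_i

variable {D : Type v} [Category.{u} D] [HasFiniteLimits D] [HasFiniteCoproducts D]
  (C : HomotopyCylinder D)

lemma i₀_naturality_assoc {X Y Z : D} (f : X ⟶ Y) (g : C.cyl.obj Y ⟶ Z) :
    C.i₀ X ≫ C.cyl.map f ≫ g = f ≫ C.i₀ Y ≫ g := by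
  rw [← Category.assoc, i₀_naturality, Category.assoc]

lemma i₁_naturality_assoc {X Y Z : D} (f : X ⟶ Y) (g : C.cyl.obj Y ⟶ Z) :
    C.i₁ X ≫ C.cyl.map f ≫ g = f ≫ C.i₁ Y ≫ g := by
  rw [← Category.assoc, i₁_naturality, Category.assoc]

lemma pr_naturality_assoc {X Y Z : D} (f : X ⟶ Y) (g : Y ⟶ Z) :
    C.cyl.map f ≫ C.pr Y ≫ g = C.pr X ≫ f ≫ g := by
  rw [← Category.assoc, pr_naturality, Category.assoc]

@[simp]
lemma i₀_pr_assoc {X Z : D} (g : X ⟶ Z) : C.i₀ X ≫ C.pr X ≫ g = g := by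
  rw [← Category.assoc, i₀_pr, Category.id_comp]

@[simp]
lemma i₁_pr_assoc {X Z : D} (g : X ⟶ Z) : C.i₁ X ≫ C.pr X ≫ g = g := by
  rw [← Category.assoc, i₁_pr, Category.id_comp]

/-- Homotopies for the given cylinder. -/
def Homotopic {X W : D} (f g : X ⟶ W) : Prop :=
  ∃ h : C.cyl.obj X ⟶ W, C.i₀ X ≫ h = f ∧ C.i₁ X ≫ h = g

namespace Homotopic

variable {C}

lemma refl {X W : D} (f : X ⟶ W) : C.Homotopic f f := ⟨C.pr X ≫ f, by simp, by simp⟩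

lemma precomp {X Y W : D} (p : X ⟶ Y) {f g : Y ⟶ W} (h : C.Homotopic f g) :
    C.Homotopic (p ≫ f) (p ≫ g) := by
  obtain ⟨h, rfl, rfl⟩ := h
  exact ⟨C.cyl.map p ≫ h, C.i₀_naturality_assoc _ _, C.i₁_naturality_assoc _ _⟩

lemma postcomp {X W Z : D} {f g : X ⟶ W} (h : C.Homotopic f g) (p : W ⟶ Z) :
    C.Homotopic (f ≫ p) (g ≫ p) := by
  obtain ⟨h, rfl, rfl⟩ := h
  exact ⟨h ≫ p, by simp, by simp⟩

end Homotopic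

/-- The compatibilities of a cylinder with a class `J` of morphisms which
allow to obtain a good homotopy theory of `J`-injective objects. -/
structure IsAnodyne (J : MorphismProperty D) : Prop where
  isLeftAdjoint : C.cyl.IsLeftAdjoint
  le_monomorphisms : J ≤ MorphismProperty.monomorphisms D
  exists_lift {K L E B : D} (k : K ⟶ L) [Mono k] (p : E ⟶ B) (hp : J.rlp p)
    (a : C.cyl.obj K ⟶ E) (b : L ⟶ E) (β : C.cyl.obj L ⟶ B)
    (hab : C.i₁ K ≫ a = k ≫ b) (haβ : a ≫ p = C.cyl.map k ≫ β)
    (hbβ : b ≫ p = C.i₁ L ≫ β) :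
    ∃ γ : C.cyl.obj L ⟶ E, C.cyl.map k ≫ γ = a ∧ C.i₁ L ≫ γ = b ∧ γ ≫ p = β
  exists_extension {K L W : D} (k : K ⟶ L) (hk : J k) (hW : J.rlp (terminal.from W))
    (h : C.cyl.obj K ⟶ W) (f g : L ⟶ W) (hf : C.i₀ K ≫ h = k ≫ f)
    (hg : C.i₁ K ≫ h = k ≫ g) :
    ∃ H : C.cyl.obj L ⟶ W, C.cyl.map k ≫ H = h ∧ C.i₀ L ≫ H = f ∧ C.i₁ L ≫ H = g

/-- The weak equivalences relatively to `J`-injective objects: the morphisms inducing bijections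
on homotopy classes of maps to `J`-injective objects. -/
def weakEquivalences (J : MorphismProperty D) : MorphismProperty D := fun X Y f ↦
  ∀ W : D, J.rlp (terminal.from W) →
    (∀ g : X ⟶ W, ∃ h : Y ⟶ W, C.Homotopic (f ≫ h) g) ∧
    (∀ h h' : Y ⟶ W, C.Homotopic (f ≫ h) (f ≫ h') → C.Homotopic h h')

/-- The morphisms in `J.rlp` with a `J`-injective codomain. -/
def _root_.CategoryTheory.MorphismProperty.naiveFibrations (J : MorphismProperty D) :
    MorphismProperty D :=
  fun _ B p ↦ J.rlp p ∧ J.rlp (terminal.from B)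

namespace IsAnodyne

variable {C} {J : MorphismProperty D} (hJ : C.IsAnodyne J)

include hJ

lemma fibrant_of_rlp {E B : D} {p : E ⟶ B} (hp : J.rlp p) (hB : J.rlp (terminal.from B)) :
    J.rlp (terminal.from E) := by
  rw [← terminal.comp_from p]
  exact J.rlp.comp_mem _ _ hp hB

/-- Open box filling over `p`: `a` and `b` are opposite sides whose `i₁`-ends are joined by `w`.
Lifting against the inclusion of both ends `X ⨿ X ⟶ cyl X` fills the box, and the missing side joins
the `i₀`-ends. -/
lemma exists_square {X E B : D} (p : E ⟶ B) (hp : J.rlp p) (a b w : C.cyl.obj X ⟶ E)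
    (β : C.cyl.obj (C.cyl.obj X) ⟶ B)
    (ha : C.i₁ X ≫ a = C.i₀ X ≫ w) (hb : C.i₁ X ≫ b = C.i₁ X ≫ w)
    (haβ : C.cyl.map (C.i₀ X) ≫ β = a ≫ p) (hbβ : C.cyl.map (C.i₁ X) ≫ β = b ≫ p)
    (hwβ : C.i₁ (C.cyl.obj X) ≫ β = w ≫ p) :
    ∃ h : C.cyl.obj X ⟶ E, C.i₀ X ≫ h = C.i₀ X ≫ a ∧
      C.i₁ X ≫ h = C.i₀ X ≫ b ∧ h ≫ p = C.i₀ (C.cyl.obj X) ≫ β := by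
  have := hJ.isLeftAdjoint
  have : PreservesColimitsOfSize.{0, 0} C.cyl :=
    (Adjunction.ofIsLeftAdjoint C.cyl).leftAdjoint_preservesColimits
  let hc := mapIsColimitOfPreservesOfIsColimit C.cyl _ _ (coprodIsCoprod X X)
  obtain ⟨l, hl₁, hl₂⟩ : ∃ l : C.cyl.obj (X ⨿ X) ⟶ E, C.cyl.map coprod.inl ≫ l = a ∧
      C.cyl.map coprod.inr ≫ l = b :=
    ⟨_, (BinaryCofan.IsColimit.desc' hc a b).2⟩
  have hom_ext {Z : D} {f g : C.cyl.obj (X ⨿ X) ⟶ Z}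
      (h₁ : C.cyl.map coprod.inl ≫ f = C.cyl.map coprod.inl ≫ g)
      (h₂ : C.cyl.map coprod.inr ≫ f = C.cyl.map coprod.inr ≫ g) : f = g :=
    BinaryCofan.IsColimit.hom_ext hc h₁ h₂
  obtain ⟨γ, hγ₁, hγ₂, hγ₃⟩ := hJ.exists_lift (coprod.desc (C.i₀ X) (C.i₁ X)) p hp
    l w β (by
      ext
      · simp [← i₁_naturality_assoc, hl₁, ha, coprod.inl_desc]
      · simp [← i₁_naturality_assoc, hl₂, hb, coprod.inr_desc])
    (hom_ext (by rw [reassoc_of% hl₁, ← Functor.map_comp_assoc, coprod.inl_desc, haβ])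
      (by rw [reassoc_of% hl₂, ← Functor.map_comp_assoc, coprod.inr_desc, hbβ]))
    hwβ.symm
  refine ⟨C.i₀ _ ≫ γ, ?_, ?_, ?_⟩
  · have := C.cyl.map coprod.inl ≫= hγ₁
    rw [← Functor.map_comp_assoc, coprod.inl_desc, hl₁] at this
    rw [← this, i₀_naturality_assoc]
  · have := C.cyl.map coprod.inr ≫= hγ₁
    rw [← Functor.map_comp_assoc, coprod.inr_desc, hl₂] at this
    rw [← this, i₀_naturality_assoc]
  · rw [Category.assoc, hγ₃]

lemma symm {X W : D} (hW : J.rlp (terminal.from W)) {f g : X ⟶ W} (h : C.Homotopic f g) :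
    C.Homotopic g f := by
  obtain ⟨h, rfl, rfl⟩ := h
  -- Box with sides a constant homotopy and `h`, joined by a constant homotopy; the missing side is
  -- `h` reversed.
  obtain ⟨h', h₀, h₁, -⟩ := hJ.exists_square _ hW (C.pr X ≫ C.i₁ X ≫ h) h
    (C.pr X ≫ C.i₁ X ≫ h) (terminal.from _) (by simp) (by simp)
    (Subsingleton.elim _ _) (Subsingleton.elim _ _) (Subsingleton.elim _ _)
  exact ⟨h', by simpa using h₀, h₁⟩

lemma trans {X W : D} (hW : J.rlp (terminal.from W)) {f₁ f₂ f₃ : X ⟶ W}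
    (h : C.Homotopic f₁ f₂) (h' : C.Homotopic f₂ f₃) : C.Homotopic f₁ f₃ := by
  obtain ⟨k, hk, hk'⟩ := hJ.symm hW h'
  obtain ⟨h, h₀, h₁⟩ := h
  -- The box needs both sides to end at `f₂`, hence the reversal `k` of the second homotopy.
  obtain ⟨l, h₀, h₁, -⟩ := hJ.exists_square _ hW h k
    (C.pr X ≫ f₂) (terminal.from _) (by simp [h₁]) (by simp [hk'])
    (Subsingleton.elim _ _) (Subsingleton.elim _ _) (Subsingleton.elim _ _)
  exact ⟨l, by rw [h₀]; assumption, by rw [h₁, hk]⟩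

lemma weakEquivalences_of_homotopyEquiv {X Y : D} (f : X ⟶ Y) (g : Y ⟶ X)
    (h₁ : C.Homotopic (f ≫ g) (𝟙 X)) (h₂ : C.Homotopic (g ≫ f) (𝟙 Y)) :
    C.weakEquivalences J f := fun W hW ↦ by
  refine ⟨fun l ↦ ⟨g ≫ l, by simpa using h₁.postcomp l⟩, fun l l' h ↦ ?_⟩
  have a₁ := h₂.postcomp l
  have a₂ := h₂.postcomp l'
  simp only [Category.assoc, Category.id_comp] at a₁ a₂
  exact hJ.trans hW (hJ.symm hW a₁) (hJ.trans hW (h.precomp g) a₂)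

/-- Lifting against the initial inclusion gives a section, and lifting against the two ends of the
cylinder makes it a homotopy inverse. -/
lemma rlp_monomorphisms_le [InitialMonoClass D] :
    (MorphismProperty.monomorphisms D).rlp ≤ C.weakEquivalences J := by
  intro E B p hp
  have := hp _ (MorphismProperty.monomorphisms.infer_property (initial.to B))
  have sq : CommSq (initial.to E) (initial.to B) p (𝟙 B) := ⟨by simp⟩
  have := hp _ (MorphismProperty.monomorphisms.infer_property
    (coprod.desc (C.i₀ E) (C.i₁ E)))
  have sq' : CommSq (coprod.desc (p ≫ sq.lift) (𝟙 E)) (coprod.desc (C.i₀ E) (C.i₁ E)) p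
    (C.pr E ≫ p) := ⟨by ext <;> simp⟩
  have h₀ := coprod.inl ≫= sq'.fac_left
  have h₁ := coprod.inr ≫= sq'.fac_left
  simp only [coprod.inl_desc_assoc, coprod.inr_desc_assoc, coprod.inl_desc,
    coprod.inr_desc] at h₀ h₁
  refine hJ.weakEquivalences_of_homotopyEquiv p sq.lift ⟨sq'.lift, h₀, h₁⟩ ?_
  rw [sq.fac_right]
  exact .refl _

lemma weakEquivalences_comp {X Y Z : D} {f : X ⟶ Y} {g : Y ⟶ Z}
    (hf : C.weakEquivalences J f) (hg : C.weakEquivalences J g) :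
    C.weakEquivalences J (f ≫ g) := fun W hW ↦ by
  refine ⟨fun l ↦ ?_, fun l l' h ↦ (hg W hW).2 _ _ ((hf W hW).2 _ _ (by simpa using h))⟩
  obtain ⟨l', h⟩ := (hf W hW).1 l
  obtain ⟨l'', h'⟩ := (hg W hW).1 l'
  exact ⟨l'', hJ.trans hW (by simpa using h'.precomp f) h⟩

lemma weakEquivalences_of_postcomp {X Y Z : D} {f : X ⟶ Y} {g : Y ⟶ Z}
    (hg : C.weakEquivalences J g) (hfg : C.weakEquivalences J (f ≫ g)) :
    C.weakEquivalences J f := fun W hW ↦ by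
  refine ⟨fun l ↦ ?_, fun l l' h ↦ ?_⟩
  · obtain ⟨l', h⟩ := (hfg W hW).1 l
    exact ⟨g ≫ l', by simpa using h⟩
  · obtain ⟨m, hm⟩ := (hg W hW).1 l
    obtain ⟨m', hm'⟩ := (hg W hW).1 l'
    have := (hfg W hW).2 m m' (by
      simp only [Category.assoc]
      exact hJ.trans hW (hm.precomp f) (hJ.trans hW h (hJ.symm hW (hm'.precomp f))))
    exact hJ.trans hW (hJ.symm hW hm) (hJ.trans hW (this.precomp g) hm')

lemma weakEquivalences_of_precomp {X Y Z : D} {f : X ⟶ Y} {g : Y ⟶ Z}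
    (hf : C.weakEquivalences J f) (hfg : C.weakEquivalences J (f ≫ g)) :
    C.weakEquivalences J g := fun W hW ↦ by
  refine ⟨fun l ↦ ?_, fun l l' h ↦ (hfg W hW).2 _ _ (by simpa using h.precomp f)⟩
  obtain ⟨l', h⟩ := (hfg W hW).1 (f ≫ l)
  exact ⟨l', (hf W hW).2 _ _ (by simpa using h)⟩

lemma hasTwoOutOfThreeProperty : (C.weakEquivalences J).HasTwoOutOfThreeProperty where
  comp_mem _ _ := hJ.weakEquivalences_comp
  of_postcomp _ _ := hJ.weakEquivalences_of_postcomp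
  of_precomp _ _ := hJ.weakEquivalences_of_precomp

/-- The map `p` is a fiberwise deformation retraction: a homotopy inverse is deformed to a strict
section `s`, then the homotopy from the identity to `p ≫ s` is deformed to one over `B`. Lifting a
constant homotopy of the base then solves any lifting problem. -/
lemma monomorphisms_rlp_of_weakEquivalences [InitialMonoClass D] {E B : D} (p : E ⟶ B)
    (hp : J.rlp p) (hB : J.rlp (terminal.from B)) (hp' : C.weakEquivalences J p) :
    (MorphismProperty.monomorphisms D).rlp p := by
  have := hJ.isLeftAdjoint
  have : PreservesColimitsOfSize.{0, 0} C.cyl :=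
    (Adjunction.ofIsLeftAdjoint C.cyl).leftAdjoint_preservesColimits
  have hE := hJ.fibrant_of_rlp hp hB
  obtain ⟨s₀, hs₀⟩ := (hp' E hE).1 (𝟙 E)
  obtain ⟨h, h₀, h₁⟩ : C.Homotopic (𝟙 B) (s₀ ≫ p) := hJ.symm hB ((hp' B hB).2 _ _
    (by simpa using hs₀.postcomp p))
  let hi : IsInitial (C.cyl.obj (⊥_ D)) := IsInitial.isInitialObj C.cyl _ initialIsInitial
  -- Lift the homotopy from the identity to `s₀ ≫ p` with end `s₀`; its other end is a strict
  -- section.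
  obtain ⟨γ, -, hγ₁, hγ₂⟩ := hJ.exists_lift (initial.to B) p hp (hi.to E) s₀ h
    (Subsingleton.elim _ _) (hi.hom_ext _ _) h₁.symm
  obtain ⟨s, hs⟩ : ∃ s, s = C.i₀ B ≫ γ := ⟨_, rfl⟩
  have hsp : s ≫ p = 𝟙 B := by rw [hs, Category.assoc, hγ₂, h₀]
  obtain ⟨k, hk₀, hk₁⟩ : C.Homotopic (𝟙 E) (p ≫ s) :=
    hJ.symm hE (hJ.trans hE (Homotopic.precomp p ⟨γ, hs.symm, hγ₁⟩) hs₀)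
  -- The sides `k` and `k ≫ p ≫ s` have the same image in `B` since `s` is a section. The missing
  -- side therefore lies over a constant homotopy and still joins the identity to `p ≫ s`.
  obtain ⟨k', hk'₀, hk'₁, hk'⟩ := hJ.exists_square p hp k (k ≫ p ≫ s) (C.pr E ≫ p ≫ s)
    (C.cyl.map (C.pr E) ≫ k ≫ p) (by simp [hk₁]) (by simp [reassoc_of% hk₁, reassoc_of% hsp])
    (by simp [← Functor.map_comp_assoc]) (by simp [← Functor.map_comp_assoc, hsp])
    (by simp [i₁_naturality_assoc, reassoc_of% hk₁])
  rw [reassoc_of% hk₀] at hk'₁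
  rw [hk₀] at hk'₀
  rw [i₀_naturality_assoc, reassoc_of% hk₀] at hk'
  intro K L m hm
  refine ⟨fun {a b} sq ↦ ⟨⟨?_⟩⟩⟩
  have : Mono m := hm
  have hw := sq.w
  -- The map `b ≫ s` solves the problem up to the homotopy `k'` on `K`; transporting it back along
  -- `k'` gives a solution at the end `i₀`.
  have : ∃ γ : C.cyl.obj L ⟶ E, C.cyl.map m ≫ γ = C.cyl.map a ≫ k' ∧ C.i₁ L ≫ γ = b ≫ s ∧
      γ ≫ p = C.pr L ≫ b :=
    hJ.exists_lift m p hp (C.cyl.map a ≫ k') (b ≫ s) (C.pr L ≫ b)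
      (by rw [i₁_naturality_assoc, hk'₁, reassoc_of% hw])
      (by rw [Category.assoc, hk', pr_naturality_assoc, hw, pr_naturality_assoc])
      (by simp [hsp])
  choose γ hγ₁ hγ₂ hγ₃ using this
  exact ⟨C.i₀ L ≫ γ, by rw [← i₀_naturality_assoc, hγ₁, i₀_naturality_assoc, hk'₀,
    Category.comp_id], by simp [hγ₃]⟩

/-- The path object is the right adjoint of the cylinder applied to `W`. Lifting `J` against its
endpoint map is, by transposition, the extension of homotopies between prescribed maps. -/
lemma naiveFibrations_pathObject {W : D} (hW : J.rlp (terminal.from W)) :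
    ∃ (P : D) (e : P ⟶ W ⨯ W) (ev : C.cyl.obj P ⟶ W), J.naiveFibrations e ∧
      C.i₀ P ≫ ev = e ≫ prod.fst ∧ C.i₁ P ≫ ev = e ≫ prod.snd ∧
        ∀ {X : D} (h : C.cyl.obj X ⟶ W), ∃! t : X ⟶ P, C.cyl.map t ≫ ev = h := by
  have := hJ.isLeftAdjoint
  let adj := Adjunction.ofIsLeftAdjoint C.cyl
  refine ⟨(C.cyl.rightAdjoint).obj W, prod.lift (C.i₀ _ ≫ adj.counit.app W)
    (C.i₁ _ ≫ adj.counit.app W), adj.counit.app W, ⟨?_, ?_⟩, by rw [prod.lift_fst], by rw [prod.lift_snd],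
    fun {X} h ↦ ⟨adj.homEquiv _ _ h, by simp [Adjunction.homEquiv_unit], fun t ht ↦ by
      rw [← ht, ← Adjunction.homEquiv_counit, Equiv.apply_symm_apply]⟩⟩
  · intro K L k hk
    refine ⟨fun {a b} sq ↦ ⟨⟨?_⟩⟩⟩
    have h₀ := sq.w =≫ prod.fst
    have h₁ := sq.w =≫ prod.snd
    simp only [Category.assoc, prod.lift_fst, prod.lift_snd] at h₀ h₁
    have := hJ.exists_extension k hk hW ((adj.homEquiv _ _).symm a) (b ≫ prod.fst) (b ≫ prod.snd)
      (by rw [← h₀, Adjunction.homEquiv_counit, i₀_naturality_assoc])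
      (by rw [← h₁, Adjunction.homEquiv_counit, i₁_naturality_assoc])
    choose H hH h₀ h₁ using this
    refine ⟨adj.homEquiv _ _ H, ?_, ?_⟩
    · rw [← Adjunction.homEquiv_naturality_left, hH, Equiv.apply_symm_apply]
    · ext
      · rw [← h₀]
        simp [← i₀_naturality_assoc, Adjunction.homEquiv_unit, prod.lift_fst]
      · rw [← h₁]
        simp [← i₁_naturality_assoc, Adjunction.homEquiv_unit, prod.lift_snd]
  · have h : J.rlp (prod.snd : W ⨯ W ⟶ W) :=
      MorphismProperty.of_isPullback (IsPullback.of_is_product' (prodIsProd W W) terminalIsTerminal) hW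
    exact hJ.fibrant_of_rlp h hW

/-- Lifting against `W ⟶ ⊤_ D` gives surjectivity on homotopy classes; lifting against the endpoint
map of the path object gives injectivity. -/
lemma naiveFibrations_llp_le : J.naiveFibrations.llp ≤ C.weakEquivalences J := by
  intro X Y f hf W hW
  have h1 : J.rlp (terminal.from (⊤_ D)) := by
    rw [Subsingleton.elim (terminal.from (⊤_ D)) (𝟙 _)]
    exact J.rlp.id_mem _
  refine ⟨fun g ↦ ?_, fun l l' h ↦ ?_⟩
  · have := hf _ ⟨hW, h1⟩
    have sq : CommSq g f (terminal.from W) (terminal.from Y) := ⟨Subsingleton.elim _ _⟩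
    refine ⟨sq.lift, ?_⟩
    rw [sq.fac_left]
    exact .refl g
  · obtain ⟨P, e, ev, he, h₀, h₁, H⟩ := hJ.naiveFibrations_pathObject hW
    obtain ⟨h, hh₀, hh₁⟩ := h
    obtain ⟨t, ht, -⟩ := H h
    have := hf _ he
    have sq : CommSq t f e (prod.lift l l') := ⟨by
      ext
      · simp [← hh₀, ← ht, ← h₀, i₀_naturality_assoc, prod.lift_fst]
      · simp [← hh₁, ← ht, ← h₁, i₁_naturality_assoc, prod.lift_snd]⟩
    refine ⟨C.cyl.map sq.lift ≫ ev, ?_, ?_⟩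
    · rw [i₀_naturality_assoc, h₀, sq.fac_right_assoc, prod.lift_fst]
    · rw [i₁_naturality_assoc, h₁, sq.fac_right_assoc, prod.lift_snd]

lemma llp_rlp_le : J.rlp.llp ≤ C.weakEquivalences J :=
  (MorphismProperty.antitone_llp (fun _ _ _ h ↦ h.1)).trans hJ.naiveFibrations_llp_le

/-- Replace the base by an injective object `Y'.Z` over `B`, then factor `X ⟶ Y'.Z`. The second
factor is a weak equivalence between injective objects, so it lifts against `f`, while the first
factor lifts against `p`; the two lifts compose. -/
lemma le_naiveFibrations_llp [InitialMonoClass D]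
    [MorphismProperty.HasFactorization J.rlp.llp J.rlp] {X Y : D} (f : X ⟶ Y) [Mono f]
    (hf : C.weakEquivalences J f) : J.naiveFibrations.llp f := by
  rintro E B p ⟨hp, hB⟩
  refine ⟨fun {t b} sq ↦ ⟨⟨?_⟩⟩⟩
  let Y' := MorphismProperty.factorizationData J.rlp.llp J.rlp b
  let X' := MorphismProperty.factorizationData J.rlp.llp J.rlp (f ≫ Y'.i)
  have hq : (MorphismProperty.monomorphisms D).rlp X'.p :=
    hJ.monomorphisms_rlp_of_weakEquivalences X'.p X'.hp (hJ.fibrant_of_rlp Y'.hp hB)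
      (hJ.weakEquivalences_of_precomp (hJ.llp_rlp_le _ X'.hi) (by
        rw [X'.fac]
        exact hJ.weakEquivalences_comp hf (hJ.llp_rlp_le _ Y'.hi)))
  have := hq f ‹_›
  have sq₁ : CommSq X'.i f X'.p Y'.i := ⟨X'.fac⟩
  have := X'.hi p hp
  have sq₂ : CommSq t X'.i p (X'.p ≫ Y'.p) := ⟨by simp [sq.w]⟩
  exact ⟨sq₁.lift ≫ sq₂.lift, by simp, by simp⟩

end IsAnodyne

end HomotopyCylinder

end CategoryTheory

/-! ### Presentability of arrow categories; the small object argument -/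

namespace CategoryTheory

open Limits Opposite

attribute [local instance] Cardinal.fact_isRegular_aleph0

namespace Arrow

variable {D : Type v} [Category.{u} D]

section

variable [HasColimitsOfSize.{u, u} D]

instance (κ : Cardinal.{u}) [Fact κ.IsRegular] (G : D) [IsCardinalPresentable G κ] :
    IsCardinalPresentable (Arrow.mk (𝟙 G)) κ where
  preservesColimitOfShape J _ _ := by
    let e : Arrow.leftFunc ⋙ coyoneda.obj (op G) ≅ coyoneda.obj (op (Arrow.mk (𝟙 G))) :=
      NatIso.ofComponents (fun X ↦ Equiv.toIso
        { toFun f := Arrow.homMk (u := f) (v := (f : G ⟶ X.left) ≫ X.hom) (Category.id_comp _).symm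
          invFun f := f.left
          left_inv _ := rfl
          right_inv f := Arrow.hom_ext _ _ rfl (by
            have := f.w
            dsimp at this ⊢
            rwa [Category.id_comp] at this) }) (fun f ↦ by
            ext g
            refine Arrow.hom_ext _ _ rfl ?_
            exact (Category.assoc _ _ _).trans ((congr_arg (fun t ↦ g ≫ t) f.w).trans (Category.assoc _ _ _).symm))
    have := preservesColimitsOfShape_of_isCardinalPresentable G κ J
    exact preservesColimitsOfShape_of_natIso e

instance (κ : Cardinal.{u}) [Fact κ.IsRegular] (G : D) [IsCardinalPresentable G κ] :
    IsCardinalPresentable (Arrow.mk (initial.to G)) κ where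
  preservesColimitOfShape J _ _ := by
    let e : Arrow.rightFunc ⋙ coyoneda.obj (op G) ≅ coyoneda.obj (op (Arrow.mk (initial.to G))) :=
      NatIso.ofComponents (fun X ↦ Equiv.toIso
        { toFun f := Arrow.homMk (u := initial.to _) (v := f) (initialIsInitial.hom_ext _ _)
          invFun f := f.right
          left_inv _ := rfl
          right_inv f := Arrow.hom_ext _ _ (initialIsInitial.hom_ext _ _) rfl }) (fun f ↦ by
            ext g
            exact Arrow.hom_ext _ _ (initialIsInitial.hom_ext _ _) rfl)
    have := preservesColimitsOfShape_of_isCardinalPresentable G κ J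
    exact preservesColimitsOfShape_of_natIso e

/-- The arrow `k` is the pushout of `∅ ⟶ L` and `𝟙 K` along `∅ ⟶ K`, and these arrows corepresent
`Hom(L, right)`, `Hom(K, left)` and `Hom(K, right)`. -/
lemma isFinitelyPresentable {K L : D} (k : K ⟶ L) [IsFinitelyPresentable.{u} K]
    [IsFinitelyPresentable.{u} L] : IsFinitelyPresentable.{u} (Arrow.mk k) := by
  let a : Arrow.mk (initial.to K) ⟶ Arrow.mk (initial.to L) := Arrow.homMk (𝟙 _) k
  let b : Arrow.mk (initial.to K) ⟶ Arrow.mk (𝟙 K) := Arrow.homMk (initial.to _) (𝟙 K)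
  let c : Arrow.mk (initial.to L) ⟶ Arrow.mk k := Arrow.homMk (initial.to _) (𝟙 L)
  let d : Arrow.mk (𝟙 K) ⟶ Arrow.mk k := Arrow.homMk (𝟙 K) k
  have w : a ≫ c = b ≫ d := Arrow.hom_ext _ _ (initialIsInitial.hom_ext _ _) (by simp [a, b, c, d])
  have hs (s : PushoutCocone a b) : k ≫ s.inl.right = s.inr.right := by
    simpa [a, b] using congr_arg CommaMorphism.right s.condition
  have hc : IsColimit (PushoutCocone.mk c d w) := PushoutCocone.IsColimit.mk _
    (fun s ↦ Arrow.homMk s.inr.left s.inl.right (by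
      have := s.inr.w
      dsimp at this ⊢
      rw [this, Category.id_comp, hs]))
    (fun s ↦ Arrow.hom_ext _ _ (initialIsInitial.hom_ext _ _) (by simp [c]))
    (fun s ↦ Arrow.hom_ext _ _ (by simp [d]) (by simp [d, hs]))
    (fun s m h₁ h₂ ↦ Arrow.hom_ext _ _ (by simp [← h₂, d]) (by simp [← h₁, c]))
  have : ∀ j, IsCardinalPresentable ((span a b).obj j) Cardinal.aleph0.{u} := by
    rintro (_ | _ | _)
    · exact inferInstanceAs (IsCardinalPresentable (Arrow.mk (initial.to K)) _)
    · exact inferInstanceAs (IsCardinalPresentable (Arrow.mk (initial.to L)) _)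
    · exact inferInstanceAs (IsCardinalPresentable (Arrow.mk (𝟙 K)) _)
  exact isCardinalPresentable_of_isColimit'.{u} _ hc _ (hasCardinalLT_of_finite _ _ le_rfl)

end

instance isCardinalLocallyPresentable (κ : Cardinal.{u}) [Fact κ.IsRegular]
    [IsCardinalLocallyPresentable D κ] : IsCardinalLocallyPresentable (Arrow D) κ := by
  obtain ⟨P, _, hP, hP'⟩ := (IsCardinalLocallyPresentable.iff_exists_isStrongGenerator D κ).1
    inferInstance
  rw [ObjectProperty.isStrongGenerator_iff] at hP
  obtain ⟨h₁, h₂⟩ := hP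
  rw [IsCardinalLocallyPresentable.iff_exists_isStrongGenerator]
  let Q : ObjectProperty (Arrow D) :=
    ObjectProperty.ofObj (Sum.elim (fun (G : Subtype P) ↦ Arrow.mk (𝟙 G.1))
      (fun (G : Subtype P) ↦ Arrow.mk (initial.to G.1)))
  have hQ₁ {G : D} (hG : P G) : Q (Arrow.mk (𝟙 G)) := ObjectProperty.ofObj_apply _ (Sum.inl (⟨G, hG⟩ : Subtype P))
  have hQ₂ {G : D} (hG : P G) : Q (Arrow.mk (initial.to G)) := ObjectProperty.ofObj_apply _ (Sum.inr (⟨G, hG⟩ : Subtype P))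
  let s {G : D} {X : Arrow D} (g : G ⟶ X.left) : Arrow.mk (𝟙 G) ⟶ X :=
    Arrow.homMk g (g ≫ X.hom)
  let t {G : D} {X : Arrow D} (g : G ⟶ X.right) : Arrow.mk (initial.to G) ⟶ X :=
    Arrow.homMk (initial.to _) g (initialIsInitial.hom_ext _ _)
  refine ⟨Q, inferInstance, ?_, ?_⟩
  · rw [ObjectProperty.isStrongGenerator_iff]
    refine ⟨fun X Y f g h ↦ Arrow.hom_ext _ _ (h₁ _ _ fun G hG x ↦ ?_)
      (h₁ _ _ fun G hG x ↦ ?_), fun X Y i _ h ↦ ?_⟩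
    · exact congr_arg CommaMorphism.left (h _ (hQ₁ hG) (s x))
    · exact congr_arg CommaMorphism.right (h _ (hQ₂ hG) (t x))
    · have : Mono i.left := ⟨fun {Z} a b hab ↦ by
        have : s a = s b := by
          rw [← cancel_mono i]
          exact Arrow.hom_ext _ _ hab (by
            simp only [s, Arrow.comp_right, Arrow.homMk_right, Category.assoc]
            rw [← Arrow.w i, reassoc_of% hab])
        exact congr_arg CommaMorphism.left this⟩
      have : Mono i.right := ⟨fun {Z} a b hab ↦ by
        have : t a = t b := by
          rw [← cancel_mono i]
          exact Arrow.hom_ext _ _ (initialIsInitial.hom_ext _ _) hab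
        exact congr_arg CommaMorphism.right this⟩
      have : IsIso i.left := h₂ _ (fun G hG x ↦ by
        obtain ⟨y, hy⟩ := h _ (hQ₁ hG) (s x)
        exact ⟨y.left, congr_arg CommaMorphism.left hy⟩)
      have : IsIso i.right := h₂ _ (fun G hG x ↦ by
        obtain ⟨y, hy⟩ := h _ (hQ₂ hG) (t x)
        exact ⟨y.right, congr_arg CommaMorphism.right hy⟩)
      exact Arrow.isIso_of_isIso_left_of_isIso_right i
  · rintro _ ⟨G | G⟩
    · have : IsCardinalPresentable G.1 κ := hP' _ G.2
      exact inferInstanceAs (IsCardinalPresentable (Arrow.mk (𝟙 G.1)) κ)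
    · have : IsCardinalPresentable G.1 κ := hP' _ G.2
      exact inferInstanceAs (IsCardinalPresentable (Arrow.mk (initial.to G.1)) κ)

instance [HasColimitsOfSize.{u, u} D] (F : D ⥤ D) (κ : Cardinal.{u}) [Fact κ.IsRegular] [F.IsCardinalAccessible κ] :
    F.mapArrow.IsCardinalAccessible κ where
  preservesColimitOfShape J _ _ := by
    have := F.preservesColimitsOfShape_of_isCardinalAccessible κ J
    exact ⟨fun {K} ↦ ⟨fun {c} hc ↦ ⟨Comma.fstSndJointlyReflectColimit
      (isColimitOfPreserves (Arrow.leftFunc ⋙ F) hc)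
      (isColimitOfPreserves (Arrow.rightFunc ⋙ F) hc)⟩⟩⟩

end Arrow

lemma MorphismProperty.hasSmallObjectArgument_of_isLocallyPresentable {D : Type v}
    [Category.{u} D] [IsLocallyPresentable.{u} D] (J : MorphismProperty D)
    [MorphismProperty.IsSmall.{u} J] : HasSmallObjectArgument.{u} J := by
  obtain ⟨κ₀, _, _⟩ := IsLocallyPresentable.exists_cardinal.{u} D
  let P : ObjectProperty D := ObjectProperty.ofObj (fun f : J.toSet ↦ f.1.left)
  obtain ⟨κ, hκ, h, -⟩ := P.exists_regular_cardinal_le_isCardinalPresentable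
    (ι := PEmpty.{1}) (fun x ↦ x.elim)
  have : Nonempty κ.ord.ToType := by simpa using Cardinal.IsRegular.ne_zero Fact.out
  let : OrderBot κ.ord.ToType := WellFoundedLT.toOrderBot _
  refine ⟨κ, hκ, inferInstance,
    { preservesColimit {A B X Y} i hi f hf := by
        have : IsCardinalPresentable A κ := h _ (ObjectProperty.ofObj_apply _ (⟨CategoryTheory.Arrow.mk i, hi⟩ : J.toSet))
        exact (preservesColimitsOfShape_of_isCardinalPresentable A κ κ.ord.ToType).preservesColimit }⟩

end CategoryTheory

/-! ### Weak equivalences between injective objects as a homotopy lifting property -/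

namespace CategoryTheory

open Limits Opposite

attribute [local instance] Cardinal.fact_isRegular_aleph0

instance MorphismProperty.isSmall_sup {D : Type*} [Category* D] (W₁ W₂ : MorphismProperty D)
    [MorphismProperty.IsSmall.{u} W₁] [MorphismProperty.IsSmall.{u} W₂] :
    MorphismProperty.IsSmall.{u} (W₁ ⊔ W₂) where
  small_toSet := by
    refine small_of_surjective (f := fun (x : W₁.toSet ⊕ W₂.toSet) ↦
      x.elim (fun f ↦ (⟨f.1, Or.inl f.2⟩ : (W₁ ⊔ W₂).toSet)) (fun f ↦ ⟨f.1, Or.inr f.2⟩)) ?_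
    rintro ⟨f, hf | hf⟩
    · exact ⟨Sum.inl ⟨f, hf⟩, rfl⟩
    · exact ⟨Sum.inr ⟨f, hf⟩, rfl⟩

namespace HomotopyCylinder

section

variable {D : Type v} [Category.{u} D] [HasFiniteLimits D] [HasFiniteCoproducts D]
  (C : HomotopyCylinder D)

/-- The lifting property up to homotopy, relatively to the source of `k`. -/
def HomotopyLifting {K L X Y : D} (k : K ⟶ L) (q : X ⟶ Y) : Prop :=
  ∀ (a : K ⟶ X) (y : L ⟶ Y) (h : C.cyl.obj K ⟶ Y), C.i₀ K ≫ h = k ≫ y → C.i₁ K ≫ h = a ≫ q →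
    ∃ (c : L ⟶ X) (H : C.cyl.obj L ⟶ Y), k ≫ c = a ∧ C.cyl.map k ≫ H = h ∧
      C.i₀ L ≫ H = y ∧ C.i₁ L ≫ H = c ≫ q

variable {C} {J : MorphismProperty D}

/-- The mapping path object `X ×_Y Path(Y)`: a map to it is a map `a` to `X` with a homotopy ending
at `a ≫ q`. It replaces `q` by the `J`-fibration `π`, up to the trivial fibration `r`. -/
lemma IsAnodyne.exists_mappingPathObject (hJ : C.IsAnodyne J) {X Y : D} (q : X ⟶ Y)
    (hX : J.rlp (terminal.from X)) (hY : J.rlp (terminal.from Y)) :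
    ∃ (E : D) (π : E ⟶ Y) (r : E ⟶ X) (ev : C.cyl.obj E ⟶ Y),
      J.rlp π ∧ (MorphismProperty.monomorphisms D).rlp r ∧ C.i₀ E ≫ ev = π ∧
      C.i₁ E ≫ ev = r ≫ q ∧
      ∀ {T : D} (a : T ⟶ X) (h : C.cyl.obj T ⟶ Y), C.i₁ T ≫ h = a ≫ q →
        ∃! t : T ⟶ E, t ≫ r = a ∧ C.cyl.map t ≫ ev = h := by
  obtain ⟨P, e, ev, ⟨he, -⟩, he₀, he₁, hP⟩ := hJ.naiveFibrations_pathObject hY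
  have hom_ext {T : D} {t t' : T ⟶ P} (h : C.cyl.map t ≫ ev = C.cyl.map t' ≫ ev) : t = t' :=
    (hP _).unique h rfl
  refine ⟨pullback q (e ≫ prod.snd), pullback.snd _ _ ≫ e ≫ prod.fst, pullback.fst _ _,
    C.cyl.map (pullback.snd _ _) ≫ ev, ?_, ?_, ?_, ?_, ?_⟩
  · intro K L k hk
    refine ⟨fun {s y} sq ↦ ?_⟩
    have := hX k hk
    have sq₁ : CommSq (s ≫ pullback.fst _ _) k (terminal.from X) (terminal.from L) :=
      ⟨Subsingleton.elim _ _⟩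
    have := he k hk
    have sq₂ : CommSq (s ≫ pullback.snd _ _) k e (prod.lift y (sq₁.lift ≫ q)) := ⟨by
      ext
      · simpa only [Category.assoc, prod.lift_fst] using sq.w
      · simp only [Category.assoc, prod.lift_snd, sq₁.fac_left_assoc, pullback.condition]⟩
    refine ⟨⟨pullback.lift sq₁.lift sq₂.lift (by simp [prod.lift_snd]), ?_, ?_⟩⟩
    · ext <;> simp [pullback.lift_fst, pullback.lift_snd]
    · simp [prod.lift_fst, pullback.lift_snd_assoc]
  · intro K L k (hk : Mono k)
    refine ⟨fun {s x} sq ↦ ?_⟩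
    obtain ⟨γ, hγ₁, hγ₂, -⟩ := hJ.exists_lift k (terminal.from Y) hY
      (C.cyl.map (s ≫ pullback.snd _ _) ≫ ev) (x ≫ q) (terminal.from _) (by
        rw [i₁_naturality_assoc, he₁, Category.assoc, ← pullback.condition, ← sq.w_assoc])
      (Subsingleton.elim _ _) (Subsingleton.elim _ _)
    obtain ⟨t, ht, -⟩ := hP γ
    refine ⟨⟨pullback.lift x t ?_, ?_, ?_⟩⟩
    · rw [← he₁, ← i₁_naturality_assoc, ht, hγ₂]
    · ext
      · simp [sq.w, pullback.lift_fst]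
      · rw [Category.assoc, pullback.lift_snd]
        apply hom_ext
        rw [Functor.map_comp, Category.assoc, ht, hγ₁]
    · simp [pullback.lift_fst]
  · rw [i₀_naturality_assoc, he₀]
  · rw [i₁_naturality_assoc, he₁, pullback.condition]
  · intro T a h hah
    obtain ⟨t, ht, -⟩ := hP h
    refine ⟨pullback.lift a t ?_, ⟨pullback.lift_fst _ _ _, ?_⟩, ?_⟩
    · rw [← he₁, ← i₁_naturality_assoc, ht, hah]
    · rw [← Functor.map_comp_assoc, pullback.lift_snd, ht]
    · rintro t' ⟨ht₁, ht₂⟩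
      ext
      · simp [ht₁, pullback.lift_fst]
      · apply hom_ext
        rw [pullback.lift_snd, ht, ← ht₂, Functor.map_comp, Category.assoc]

/-- The map `q` is a weak equivalence iff `π` is, iff `π` lifts against `I`; by the universal
property of `E`, this lifting is homotopy lifting for `q`. -/
lemma IsAnodyne.weakEquivalences_iff_homotopyLifting [InitialMonoClass D] (hJ : C.IsAnodyne J)
    {I : MorphismProperty D}
    (hI : I.rlp = (MorphismProperty.monomorphisms D).rlp) {X Y : D} (q : X ⟶ Y)
    (hX : J.rlp (terminal.from X)) (hY : J.rlp (terminal.from Y)) :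
    C.weakEquivalences J q ↔ ∀ ⦃K L : D⦄ (k : K ⟶ L), I k → C.HomotopyLifting k q := by
  obtain ⟨E, π, r, ev, hπ, hr, h₀, h₁, hE⟩ := hJ.exists_mappingPathObject q hX hY
  have iff₁ : C.weakEquivalences J q ↔ C.weakEquivalences J π := by
    -- The constant homotopies give a section `σ` of `r`, so `σ` is a weak equivalence with `σ ≫ π =
    -- q`.
    obtain ⟨σ, ⟨hσ₁, hσ₂⟩, -⟩ := hE (𝟙 X) (C.pr X ≫ q) (by simp)
    have hσ : C.weakEquivalences J σ :=
      hJ.weakEquivalences_of_postcomp (hJ.rlp_monomorphisms_le _ hr) (by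
        rw [hσ₁]
        exact hJ.rlp_monomorphisms_le _ (MorphismProperty.id_mem _ _))
    have hσπ : σ ≫ π = q := by
      rw [← h₀, ← i₀_naturality_assoc, hσ₂, i₀_pr_assoc]
    rw [← hσπ]
    exact ⟨hJ.weakEquivalences_of_precomp hσ, hJ.weakEquivalences_comp hσ⟩
  have iff₂ : C.weakEquivalences J π ↔ I.rlp π := by
    rw [hI]
    exact ⟨hJ.monomorphisms_rlp_of_weakEquivalences π hπ hY, fun h ↦ hJ.rlp_monomorphisms_le _ h⟩
  rw [iff₁, iff₂]
  refine ⟨fun h K L k hk a y s hs₀ hs₁ ↦ ?_, fun h K L k hk ↦ ⟨fun {s y} sq ↦ ?_⟩⟩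
  · have := h k hk
    obtain ⟨t, ⟨ht₁, ht₂⟩, -⟩ := hE a s hs₁
    have sq : CommSq t k π y := ⟨by rw [← h₀, ← i₀_naturality_assoc, ht₂, hs₀]⟩
    refine ⟨sq.lift ≫ r, C.cyl.map sq.lift ≫ ev, by simp [ht₁], ?_, ?_, ?_⟩
    · rw [← Functor.map_comp_assoc, sq.fac_left, ht₂]
    · rw [i₀_naturality_assoc, h₀, sq.fac_right]
    · rw [i₁_naturality_assoc, h₁, Category.assoc]
  · obtain ⟨c, H, hc₁, hc₂, hc₃, hc₄⟩ := h k hk (s ≫ r) y (C.cyl.map s ≫ ev)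
      (by rw [i₀_naturality_assoc, h₀, sq.w]) (by rw [i₁_naturality_assoc, h₁, Category.assoc])
    obtain ⟨t, ⟨ht₁, ht₂⟩, -⟩ := hE c H hc₄
    refine ⟨⟨t, (hE (s ≫ r) (C.cyl.map s ≫ ev) ?_).unique ⟨?_, ?_⟩ ⟨rfl, rfl⟩, ?_⟩⟩
    · rw [i₁_naturality_assoc, h₁, Category.assoc]
    · rw [Category.assoc, ht₁, hc₁]
    · rw [Functor.map_comp, Category.assoc, ht₂, hc₂]
    · rw [← h₀, ← i₀_naturality_assoc, ht₂, hc₃]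

end

section

variable {D : Type v} [Category.{u} D] [HasFiniteLimits D] [HasFiniteColimits D]
  (C : HomotopyCylinder D)

/-- The morphisms from this arrow parametrize the problems in the definition
of `HomotopyLifting`. -/
noncomputable abbrev problemArrow {K L : D} (k : K ⟶ L) : Arrow D :=
  Arrow.mk (C.i₁ K ≫ pushout.inl (C.i₀ K) k)

/-- The morphisms from this arrow parametrize the solutions in the definition
of `HomotopyLifting`. -/
abbrev solutionArrow (L : D) : Arrow D := Arrow.mk (C.i₁ L)

/-- The restriction from solutions to problems. -/
noncomputable abbrev problemArrowHom {K L : D} (k : K ⟶ L) :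
    C.problemArrow k ⟶ C.solutionArrow L :=
  Arrow.homMk k (pushout.desc (C.cyl.map k) (C.i₀ L) (C.i₀_naturality k)) (by
    simp [C.i₁_naturality k, pushout.inl_desc])

lemma homotopyLifting_iff {K L X Y : D} (k : K ⟶ L) (q : X ⟶ Y) :
    C.HomotopyLifting k q ↔ ∀ f : C.problemArrow k ⟶ Arrow.mk q,
      ∃ g : C.solutionArrow L ⟶ Arrow.mk q, C.problemArrowHom k ≫ g = f := by
  refine ⟨fun H f ↦ ?_, fun H a y h h₀ h₁ ↦ ?_⟩
  · have := f.w
    dsimp at this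
    obtain ⟨c, g, h₁, h₂, h₃, h₄⟩ := H f.left (pushout.inr _ _ ≫ f.right)
      (pushout.inl _ _ ≫ f.right) (by rw [pushout.condition_assoc]) (by rw [this, Category.assoc])
    refine ⟨Arrow.homMk c g h₄.symm, Arrow.hom_ext _ _ h₁ (pushout.hom_ext ?_ ?_)⟩
    · simpa [pushout.inl_desc_assoc] using h₂
    · simpa [pushout.inr_desc_assoc] using h₃
  · obtain ⟨g, hg⟩ := H (Arrow.homMk a (pushout.desc h y h₀) (by simp [h₁, pushout.inl_desc]))
    have hg₁ := congr_arg CommaMorphism.left hg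
    have hg₂ := congr_arg CommaMorphism.right hg
    dsimp at hg₁ hg₂
    have hg₃ := pushout.inl _ _ ≫= hg₂
    have hg₄ := pushout.inr _ _ ≫= hg₂
    simp only [Arrow.homMk_right, pushout.inl_desc, pushout.inl_desc_assoc] at hg₃
    simp only [Arrow.homMk_right, pushout.inr_desc, pushout.inr_desc_assoc] at hg₄
    exact ⟨g.left, g.right, hg₁, hg₃, hg₄, g.w.symm⟩

end

end HomotopyCylinder

end CategoryTheory

/-! ### Generating trivial cofibrations and the model structure -/

namespace CategoryTheory

open Limits Opposite

attribute [local instance] Cardinal.fact_isRegular_aleph0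

namespace HomotopyCylinder

section

variable {D : Type v} [Category.{u} D] [HasFiniteLimits D] [IsLocallyFinitelyPresentable.{u} D]
  {C : HomotopyCylinder D}

lemma IsAnodyne.weakEquivalences_injectiveEnvelope_map_iff {ι : Type u} {a b : ι → D}
    {j : ∀ i, a i ⟶ b i} (hJ : C.IsAnodyne (MorphismProperty.ofHoms j)) {X Y : D} (f : X ⟶ Y) :
    C.weakEquivalences (MorphismProperty.ofHoms j) ((InjectiveEnvelope.functor j).map f) ↔
      C.weakEquivalences (MorphismProperty.ofHoms j) f := by
  have h (X : D) := hJ.llp_rlp_le _ (InjectiveEnvelope.unit_mem j X)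
  have w := (InjectiveEnvelope.unit j).naturality f
  dsimp at w
  refine ⟨fun hf ↦ hJ.weakEquivalences_of_postcomp (h Y) ?_,
    fun hf ↦ hJ.weakEquivalences_of_precomp (h X) ?_⟩
  · rw [w]
    exact hJ.weakEquivalences_comp (h X) hf
  · rw [← w]
    exact hJ.weakEquivalences_comp hf (h Y)

variable {ι κ : Type u} {a b : ι → D} {j : ∀ i, a i ⟶ b i} {K L : κ → D} {k : ∀ i, K i ⟶ L i}

lemma IsAnodyne.fibrant_injectiveEnvelope_obj [∀ i, IsFinitelyPresentable.{u} (a i)] (X : D) :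
    (MorphismProperty.ofHoms j).rlp
      (terminal.from ((InjectiveEnvelope.functor j).obj X)) := by
  rintro _ _ _ ⟨i⟩
  refine ⟨fun {f g} sq ↦ ?_⟩
  obtain ⟨l, hl⟩ := InjectiveEnvelope.exists_extension j i f
  exact ⟨⟨l, hl, Subsingleton.elim _ _⟩⟩

variable [InitialMonoClass D] [∀ i, IsFinitelyPresentable.{u} (a i)]
  [∀ i, IsFinitelyPresentable.{u} (K i)] [∀ i, IsFinitelyPresentable.{u} (L i)]
  [∀ i, IsFinitelyPresentable.{u} (C.cyl.obj (K i))]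
  [∀ i, IsFinitelyPresentable.{u} (C.cyl.obj (L i))]

/-- Weak equivalences can be characterized by a surjectivity property for functors which
commute with filtered colimits. -/
lemma IsAnodyne.exists_surjectivityProperty_iff
    (hJ : C.IsAnodyne (MorphismProperty.ofHoms j))
    (hI : (MorphismProperty.ofHoms k).rlp = (MorphismProperty.monomorphisms D).rlp) :
    ∃ (Prob Sol : κ → Arrow D ⥤ Type u) (res : ∀ i, Sol i ⟶ Prob i),
      (∀ i, Functor.IsFinitelyAccessible.{u} (Prob i)) ∧
      (∀ i, Functor.IsFinitelyAccessible.{u} (Sol i)) ∧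
      ∀ (f : Arrow D), C.weakEquivalences (MorphismProperty.ofHoms j) f.hom ↔
        surjectivityProperty res f := by
  refine ⟨fun i ↦ (InjectiveEnvelope.functor j).mapArrow ⋙
      coyoneda.obj (op (C.problemArrow (k i))),
    fun i ↦ (InjectiveEnvelope.functor j).mapArrow ⋙ coyoneda.obj (op (C.solutionArrow (L i))),
    fun i ↦ Functor.whiskerLeft _ (coyoneda.map (C.problemArrowHom (k i)).op), ?_, ?_, ?_⟩
  · intro i
    have : IsFinitelyPresentable.{u} (pushout (C.i₀ (K i)) (k i)) := by
      have : ∀ l, IsCardinalPresentable ((span (C.i₀ (K i)) (k i)).obj l)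
          Cardinal.aleph0.{u} := by
        rintro (_ | _ | _)
        · exact inferInstanceAs (IsCardinalPresentable (K i) _)
        · exact inferInstanceAs (IsCardinalPresentable (C.cyl.obj (K i)) _)
        · exact inferInstanceAs (IsCardinalPresentable (L i) _)
      exact isCardinalPresentable_of_isColimit'.{u} _ (colimit.isColimit _) _
        (hasCardinalLT_of_finite _ _ le_rfl)
    have : IsFinitelyPresentable.{u} (C.problemArrow (k i)) := Arrow.isFinitelyPresentable _
    infer_instance
  · intro i
    have : IsFinitelyPresentable.{u} (C.solutionArrow (L i)) := Arrow.isFinitelyPresentable _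
    infer_instance
  · intro f
    rw [← hJ.weakEquivalences_injectiveEnvelope_map_iff,
      hJ.weakEquivalences_iff_homotopyLifting hI _ (fibrant_injectiveEnvelope_obj _)
        (fibrant_injectiveEnvelope_obj _)]
    refine ⟨fun h i ↦ (C.homotopyLifting_iff _ _).1 (h (k i) ⟨i⟩), ?_⟩
    rintro h _ _ _ ⟨i⟩
    exact (C.homotopyLifting_iff _ _).2 (h i)

/-- Smith's argument: every square from a generating cofibration to a weak equivalence factors
through a weak equivalence in a small set. Each such partial square is in turn factored through a
monic weak equivalence, which is added to `J`. -/
lemma IsAnodyne.exists_small_generatingTrivialCofibrations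
    (hJ : C.IsAnodyne (MorphismProperty.ofHoms j))
    (hI : (MorphismProperty.ofHoms k).rlp.llp = MorphismProperty.monomorphisms D) :
    ∃ (J' : MorphismProperty D), MorphismProperty.IsSmall.{u} J' ∧
      MorphismProperty.ofHoms j ≤ J' ∧
      J' ≤ MorphismProperty.monomorphisms D ⊓
        C.weakEquivalences (MorphismProperty.ofHoms j) ∧
      J'.rlp ⊓ C.weakEquivalences (MorphismProperty.ofHoms j) ≤
        (MorphismProperty.monomorphisms D).rlp := by
  have hI' : (MorphismProperty.ofHoms k).rlp = (MorphismProperty.monomorphisms D).rlp := by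
    rw [← hI, MorphismProperty.rlp_llp_rlp]
  have : IsLocallyPresentable.{u} D := ⟨_, inferInstance, ‹_›⟩
  have := MorphismProperty.hasSmallObjectArgument_of_isLocallyPresentable
    (MorphismProperty.ofHoms k)
  have hmono {X Y X' Y' : D} {t : X ⟶ X'} {l : X ⟶ Y} {r : X' ⟶ Y'} {b : Y ⟶ Y'}
      (sq : IsPushout t l r b) (hl : Mono l) : Mono r := by
    have : (MorphismProperty.monomorphisms D).IsStableUnderCobaseChange := by
      rw [← hI]
      infer_instance
    exact MorphismProperty.of_isPushout (P := .monomorphisms D) sq hl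
  obtain ⟨Prob, Sol, res, _, _, hW⟩ := hJ.exists_surjectivityProperty_iff hI'
  obtain ⟨S, _, hS, hS'⟩ := exists_essentiallySmall_factorization res
    (ObjectProperty.ofObj (fun i ↦ Arrow.mk (k i)))
  obtain ⟨S₀, _, hS₀, hS₀'⟩ := ObjectProperty.EssentiallySmall.exists_small_le.{u} S
  let T := Σ (s : Subtype S₀) (i : κ), (Arrow.mk (k i) ⟶ s.1)
  have key (t : T) : ∃ (Z : D) (f : t.1.1.left ⟶ Z) (p : Z ⟶ t.1.1.right) (g : L t.2.1 ⟶ Z),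
      Mono f ∧ (MorphismProperty.monomorphisms D).rlp p ∧ f ≫ p = t.1.1.hom ∧
        t.2.2.left ≫ f = k t.2.1 ≫ g ∧ g ≫ p = t.2.2.right := by
    obtain ⟨s, i, φ⟩ := t
    -- Glue the cell to the source of `s`, then factor the map to its target as a monomorphism and a
    -- trivial fibration. The composite from the source is monic, and a weak equivalence by two out
    -- of three.
    let fac := MorphismProperty.factorizationData (MorphismProperty.ofHoms k).rlp.llp
      (MorphismProperty.ofHoms k).rlp (pushout.desc s.1.hom φ.right φ.w : pushout φ.left (k i) ⟶ _)
    have h₁ : Mono fac.i := hI.le _ fac.hi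
    have hk : Mono (k i) := by
      change MorphismProperty.monomorphisms D _
      rw [← hI]
      exact MorphismProperty.le_llp_rlp _ _ ⟨i⟩
    have h₂ : Mono (pushout.inl φ.left (k i)) := hmono (IsPushout.of_hasPushout _ _) hk
    refine ⟨fac.Z, pushout.inl _ _ ≫ fac.i, fac.p, pushout.inr _ _ ≫ fac.i, mono_comp _ _,
      ?_, ?_, ?_, ?_⟩
    · rw [← hI']
      exact fac.hp
    · rw [Category.assoc, fac.fac, pushout.inl_desc]
    · rw [pushout.condition_assoc]
    · rw [Category.assoc, fac.fac, pushout.inr_desc]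
  choose Z f p g h₁ h₂ h₃ h₄ h₅ using key
  refine ⟨MorphismProperty.ofHoms j ⊔ MorphismProperty.ofHoms f, inferInstance, le_sup_left,
    sup_le (le_inf hJ.le_monomorphisms ((MorphismProperty.le_llp_rlp _).trans hJ.llp_rlp_le))
      (fun _ _ _ ⟨t⟩ ↦ ⟨h₁ t, hJ.weakEquivalences_of_postcomp
        (hJ.rlp_monomorphisms_le _ (h₂ t)) ?_⟩), ?_⟩
  · rw [h₃, hW]
    exact hS _ (hS₀ _ t.1.2)
  · rintro X Y q ⟨hq, hq'⟩
    rw [← hI']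
    rintro _ _ _ ⟨i⟩
    refine ⟨fun {x y} sq ↦ ?_⟩
    obtain ⟨s, α, β, hs, fac⟩ := hS' (Arrow.homMk x y sq.w : Arrow.mk (k i) ⟶ Arrow.mk q)
      ⟨i⟩ ((hW (Arrow.mk q)).1 hq')
    obtain ⟨s₀, hs₀, ⟨e⟩⟩ := hS₀' _ hs
    let t : T := ⟨⟨s₀, hs₀⟩, i, α ≫ e.hom⟩
    have := hq (f t) (Or.inr ⟨t⟩)
    have sq' : CommSq (e.inv ≫ β).left (f t) q (p t ≫ (e.inv ≫ β).right) :=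
      ⟨by rw [reassoc_of% (h₃ t)]; exact (e.inv ≫ β).w⟩
    have fac' : t.2.2 ≫ e.inv ≫ β = Arrow.homMk x y sq.w := by simp [t, fac]
    refine ⟨⟨g t ≫ sq'.lift, ?_, ?_⟩⟩
    · rw [← reassoc_of% (h₄ t), sq'.fac_left]
      exact congr_arg CommaMorphism.left fac'
    · rw [Category.assoc, sq'.fac_right, reassoc_of% (h₅ t)]
      exact congr_arg CommaMorphism.right fac'

/-- Fibrations are defined by lifting against `J'`. Maps in `J'` are monic weak equivalences, so
`J`-fibrations with injective codomain are fibrations; this identifies the fibrant objects and shows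
that the saturation of `J'` consists of weak equivalences. -/
theorem IsAnodyne.exists_modelCategory
    (hJ : C.IsAnodyne (MorphismProperty.ofHoms j))
    (hI : (MorphismProperty.ofHoms k).rlp.llp = MorphismProperty.monomorphisms D) :
    ∃ (_ : ModelCategory D),
      cofibrations D = MorphismProperty.monomorphisms D ∧
      HomotopicalAlgebra.weakEquivalences D = C.weakEquivalences (MorphismProperty.ofHoms j) ∧
      ∀ (X : D), IsFibrant X ↔ (MorphismProperty.ofHoms j).rlp (terminal.from X) := by
  obtain ⟨J', _, h₁, h₂, h₃⟩ := hJ.exists_small_generatingTrivialCofibrations hI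
  have : IsLocallyPresentable.{u} D := ⟨_, inferInstance, ‹_›⟩
  have := MorphismProperty.hasSmallObjectArgument_of_isLocallyPresentable
    (MorphismProperty.ofHoms k)
  have := MorphismProperty.hasSmallObjectArgument_of_isLocallyPresentable
    (MorphismProperty.ofHoms j)
  have := MorphismProperty.hasSmallObjectArgument_of_isLocallyPresentable J'
  have hI' : (MorphismProperty.ofHoms k).rlp = (MorphismProperty.monomorphisms D).rlp := by
    rw [← hI, MorphismProperty.rlp_llp_rlp]
  have hN : (MorphismProperty.ofHoms j).naiveFibrations ≤ J'.rlp := by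
    rw [← MorphismProperty.le_llp_iff_le_rlp]
    exact fun _ _ f hf ↦ have : Mono f := (h₂ _ hf).1
      hJ.le_naiveFibrations_llp f (h₂ _ hf).2
  have hJ' : J'.rlp.llp ≤ C.weakEquivalences (MorphismProperty.ofHoms j) :=
    (MorphismProperty.antitone_llp hN).trans hJ.naiveFibrations_llp_le
  let : CategoryWithCofibrations D := ⟨MorphismProperty.monomorphisms D⟩
  let : CategoryWithFibrations D := ⟨J'.rlp⟩
  let : CategoryWithWeakEquivalences D := ⟨C.weakEquivalences (MorphismProperty.ofHoms j)⟩
  have hW : (HomotopicalAlgebra.weakEquivalences D).HasTwoOutOfThreeProperty := hJ.hasTwoOutOfThreeProperty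
  have htf : trivialFibrations D = (MorphismProperty.monomorphisms D).rlp :=
    le_antisymm h₃ (le_inf (MorphismProperty.antitone_rlp (h₂.trans inf_le_left))
      hJ.rlp_monomorphisms_le)
  have htc : trivialCofibrations D = J'.rlp.llp := by
    refine le_antisymm ?_ (le_inf ?_ ?_)
    · rintro X Y f ⟨hf, hf'⟩ E B q hq
      refine ⟨fun {x y} sq ↦ ?_⟩
      -- Retract argument: the second factor of a trivial cofibration is a trivial fibration, so it
      -- lifts against `f`.
      let fac := MorphismProperty.factorizationData J'.rlp.llp J'.rlp f
      have hp : (MorphismProperty.monomorphisms D).rlp fac.p :=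
        h₃ _ ⟨fac.hp, hJ.weakEquivalences_of_precomp (hJ' _ fac.hi) (by rwa [fac.fac])⟩
      have := hp f hf
      have sq₁ : CommSq fac.i f fac.p (𝟙 Y) := ⟨by simp⟩
      have := fac.hi q hq
      have sq₂ : CommSq x fac.i q (fac.p ≫ y) := ⟨by simp [sq.w]⟩
      exact ⟨⟨sq₁.lift ≫ sq₂.lift, by simp, by simp⟩⟩
    · exact (MorphismProperty.antitone_llp (MorphismProperty.antitone_rlp
        (h₂.trans inf_le_left))).trans (by rw [← hI', hI]; rfl)
    · exact hJ'
  have : MorphismProperty.IsWeakFactorizationSystem (cofibrations D) (trivialFibrations D) := by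
    rw [htf]
    exact
      { rlp := rfl
        llp := by rw [← hI']; exact hI
        hasFactorization := by
          change MorphismProperty.HasFactorization (MorphismProperty.monomorphisms D) _
          rw [← hI', ← hI]
          infer_instance }
  have : MorphismProperty.IsWeakFactorizationSystem (trivialCofibrations D) (fibrations D) := by
    rw [htc]
    exact
      { rlp := MorphismProperty.rlp_llp_rlp _
        llp := rfl
        hasFactorization := inferInstanceAs (MorphismProperty.HasFactorization J'.rlp.llp J'.rlp) }
  refine ⟨ModelCategory.mk' D, rfl, rfl, fun X ↦ ?_⟩
  change Fibration _ ↔ _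
  rw [fibration_iff]
  refine ⟨fun h ↦ MorphismProperty.antitone_rlp h₁ _ h, fun h ↦ hN _ ⟨h, ?_⟩⟩
  rw [Subsingleton.elim (terminal.from (⊤_ D)) (𝟙 _)]
  exact MorphismProperty.id_mem _ _

end

end HomotopyCylinder

end CategoryTheory

/-! ### A model structure with all objects cofibrant is determined by its cofibrations and fibrant
objects -/

namespace HomotopicalAlgebra

open CategoryTheory Limits

variable {D : Type v} [Category.{u} D]

/-- The homotopy relation given by precylinders whose projection
belongs to a given class of morphisms. -/
def PrecylinderHomotopyRel (P : MorphismProperty D) {X Y : D} (f g : X ⟶ Y) : Prop :=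
  ∃ (Q : Precylinder X), P Q.π ∧ Nonempty (Q.LeftHomotopy f g)

section

variable [ModelCategory D]

/-- For a fibrant target a very good cylinder can be used, whose projection is a trivial fibration.
The right-hand relation refers only to the cofibrations. -/
lemma leftHomotopyRel_iff_precylinderHomotopyRel {X Y : D} [IsFibrant Y] (f g : X ⟶ Y) :
    LeftHomotopyRel f g ↔ PrecylinderHomotopyRel (cofibrations D).rlp f g := by
  refine ⟨fun h ↦ ?_, fun ⟨Q, hQ, ⟨h⟩⟩ ↦ ?_⟩
  · obtain ⟨Q, _, ⟨h⟩⟩ := h.exists_very_good_cylinder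
    refine ⟨Q.toPrecylinder, ?_, ⟨h⟩⟩
    rw [cofibrations_rlp]
    exact mem_trivialFibrations _
  · rw [cofibrations_rlp] at hQ
    have : WeakEquivalence Q.π := by
      rw [weakEquivalence_iff]
      exact hQ.2
    exact ⟨{ toPrecylinder := Q }, ⟨h⟩⟩

lemma LeftHomotopyRel.weakEquivalence_iff {X Y : D} {f g : X ⟶ Y} (h : LeftHomotopyRel f g) :
    WeakEquivalence f ↔ WeakEquivalence g := by
  obtain ⟨P, ⟨h⟩⟩ := h
  exact h.weakEquivalence_iff

/-- Factor `f` as a trivial cofibration and a fibration `fac.p`. By covering homotopy `fac.p` has a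
section `s`, and `fac.p ≫ s` is homotopic to the identity; `fac.p` is a retract of this weak
equivalence. -/
lemma weakEquivalence_of_leftHomotopyRel {X Y : D} [IsCofibrant X] [IsFibrant X] [IsCofibrant Y]
    [IsFibrant Y] (f : X ⟶ Y) (g : Y ⟶ X) (h₁ : LeftHomotopyRel (f ≫ g) (𝟙 X))
    (h₂ : LeftHomotopyRel (g ≫ f) (𝟙 Y)) : WeakEquivalence f := by
  let fac := MorphismProperty.factorizationData (trivialCofibrations D) (fibrations D) f
  have : IsFibrant fac.Z := isFibrant_of_fibration fac.p
  have : IsCofibrant fac.Z := isCofibrant_of_cofibration fac.i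
  obtain ⟨r, hr₁, hr₂⟩ := LeftHomotopyClass.whitehead fac.i
  obtain ⟨P, _, ⟨h⟩⟩ := h₂.exists_good_cylinder
  obtain ⟨s, hs, hs'⟩ := h.covering_homotopy fac.p (g ≫ fac.i) (by simp)
  have hsp : s ≫ fac.p = 𝟙 Y := by
    rw [← hs.h₁, Category.assoc, hs', h.h₁]
  have h₃ : LeftHomotopyRel (fac.p ≫ s) (𝟙 fac.Z) := by
    have a₁ : LeftHomotopyRel (fac.p ≫ s) (fac.p ≫ g ≫ fac.i) :=
      (hs.leftHomotopyRel.precomp fac.p).symm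
    have a₂ : LeftHomotopyRel (fac.p ≫ g ≫ fac.i) (r ≫ fac.i ≫ fac.p ≫ g ≫ fac.i) := by
      simpa using (hr₂.postcomp (fac.p ≫ g ≫ fac.i)).symm
    have a₃ : LeftHomotopyRel (r ≫ fac.i ≫ fac.p ≫ g ≫ fac.i) (r ≫ fac.i) := by
      simpa using (h₁.postcomp fac.i).precomp r
    exact ((a₁.trans a₂).trans a₃).trans hr₂
  have h₄ : WeakEquivalence (fac.p ≫ s) := by
    rw [h₃.weakEquivalence_iff]
    infer_instance
  have h₅ : WeakEquivalence fac.p := by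
    rw [weakEquivalence_iff] at h₄ ⊢
    let ρ : RetractArrow fac.p (fac.p ≫ s) :=
      { i := Arrow.homMk (𝟙 _) s (by simp)
        r := Arrow.homMk (𝟙 _) fac.p (by simp [hsp])
        retract := by ext <;> simp [hsp] }
    exact MorphismProperty.of_retract ρ h₄
  rw [← fac.fac]
  infer_instance

/-- For the converse, pass to fibrant replacements `X'`, `Y'`. The bijections persist, and testing
on `X'.Z` and `Y'.Z` produces a homotopy inverse. -/
lemma weakEquivalence_iff_of_isCofibrant {X Y : D} [IsCofibrant X] [IsCofibrant Y] (f : X ⟶ Y) :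
    WeakEquivalence f ↔ ∀ (W : D) (_ : IsFibrant W),
      (∀ g : X ⟶ W, ∃ h : Y ⟶ W, LeftHomotopyRel (f ≫ h) g) ∧
      (∀ h h' : Y ⟶ W, LeftHomotopyRel (f ≫ h) (f ≫ h') → LeftHomotopyRel h h') := by
  have easy {X Y : D} [IsCofibrant X] [IsCofibrant Y] (f : X ⟶ Y) [WeakEquivalence f] (W : D)
      [IsFibrant W] : (∀ g : X ⟶ W, ∃ h : Y ⟶ W, LeftHomotopyRel (f ≫ h) g) ∧
      (∀ h h' : Y ⟶ W, LeftHomotopyRel (f ≫ h) (f ≫ h') → LeftHomotopyRel h h') := by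
    obtain ⟨h₁, h₂⟩ := RightHomotopyClass.precomp_bijective_of_weakEquivalence W f
    refine ⟨fun g ↦ ?_, fun h h' hh ↦ ?_⟩
    · obtain ⟨h, hh⟩ := h₂ (.mk g)
      obtain ⟨h, rfl⟩ := h.mk_surjective
      refine ⟨h, ?_⟩
      rwa [leftHomotopyRel_iff_rightHomotopyRel, ← RightHomotopyClass.mk_eq_mk_iff]
    · rw [leftHomotopyRel_iff_rightHomotopyRel, ← RightHomotopyClass.mk_eq_mk_iff] at hh ⊢
      exact h₁ hh
  refine ⟨fun _ W _ ↦ easy f W, fun h ↦ ?_⟩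
  let X' := MorphismProperty.factorizationData (trivialCofibrations D) (fibrations D)
    (terminal.from X)
  let Y' := MorphismProperty.factorizationData (trivialCofibrations D) (fibrations D)
    (terminal.from Y)
  have : IsFibrant X'.Z := (isFibrant_iff_of_isTerminal X'.p terminalIsTerminal).2 inferInstance
  have : IsFibrant Y'.Z := (isFibrant_iff_of_isTerminal Y'.p terminalIsTerminal).2 inferInstance
  have : IsCofibrant X'.Z := isCofibrant_of_cofibration X'.i
  have : IsCofibrant Y'.Z := isCofibrant_of_cofibration Y'.i
  have sq : CommSq (f ≫ Y'.i) X'.i (terminal.from Y'.Z) (terminal.from X'.Z) :=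
    ⟨Subsingleton.elim _ _⟩
  have fac : X'.i ≫ sq.lift = f ≫ Y'.i := sq.fac_left
  have key (W : D) [IsFibrant W] :
      (∀ g : X'.Z ⟶ W, ∃ h : Y'.Z ⟶ W, LeftHomotopyRel (sq.lift ≫ h) g) ∧
      (∀ h h' : Y'.Z ⟶ W, LeftHomotopyRel (sq.lift ≫ h) (sq.lift ≫ h') →
        LeftHomotopyRel h h') := by
    refine ⟨fun g ↦ ?_, fun l l' hl ↦ ?_⟩
    · obtain ⟨l, hl⟩ := (h W ‹_›).1 (X'.i ≫ g)
      obtain ⟨l', hl'⟩ := (easy Y'.i W).1 l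
      refine ⟨l', (easy X'.i W).2 _ _ ?_⟩
      rw [reassoc_of% fac]
      exact (hl'.precomp f).trans hl
    · refine (easy Y'.i W).2 _ _ ((h W ‹_›).2 _ _ ?_)
      rw [← reassoc_of% fac, ← reassoc_of% fac]
      exact hl.precomp X'.i
  obtain ⟨g, hg⟩ := (key X'.Z).1 (𝟙 _)
  have hg' : LeftHomotopyRel (g ≫ sq.lift) (𝟙 Y'.Z) := (key Y'.Z).2 _ _ (by
    simpa using hg.postcomp sq.lift)
  have := weakEquivalence_of_leftHomotopyRel sq.lift g hg hg'
  have : WeakEquivalence (f ≫ Y'.i) := by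
    rw [← fac]
    infer_instance
  exact weakEquivalence_of_postcomp f Y'.i

lemma weakEquivalences_iff_of_isCofibrant (hD : ∀ X : D, IsCofibrant X) {X Y : D} (f : X ⟶ Y) :
    weakEquivalences D f ↔ ∀ (W : D) (_ : IsFibrant W),
      (∀ g : X ⟶ W, ∃ h : Y ⟶ W, PrecylinderHomotopyRel (cofibrations D).rlp (f ≫ h) g) ∧
      (∀ h h' : Y ⟶ W, PrecylinderHomotopyRel (cofibrations D).rlp (f ≫ h) (f ≫ h') →
        PrecylinderHomotopyRel (cofibrations D).rlp h h') := by
  have := hD X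
  have := hD Y
  rw [← weakEquivalence_iff, weakEquivalence_iff_of_isCofibrant]
  refine forall_congr' fun W ↦ forall_congr' fun _ ↦ ?_
  simp only [leftHomotopyRel_iff_precylinderHomotopyRel]

lemma fibrations_eq : fibrations D = (cofibrations D ⊓ weakEquivalences D).rlp :=
  (trivialCofibrations_rlp D).symm

end

/-- A model structure in which all objects are cofibrant is determined by its cofibrations and
its fibrant objects. -/
theorem ModelCategory.ext_of_isCofibrant (M₁ M₂ : ModelCategory D)
    (hc : @cofibrations D _ M₁.categoryWithCofibrations =
      @cofibrations D _ M₂.categoryWithCofibrations)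
    (hf : ∀ X : D, @IsFibrant D _ M₁.categoryWithFibrations _ X ↔
      @IsFibrant D _ M₂.categoryWithFibrations _ X)
    (hX : ∀ X : D, @IsCofibrant D _ M₁.categoryWithCofibrations _ X) : M₁ = M₂ := by
  have hX' (X : D) : @IsCofibrant D _ M₂.categoryWithCofibrations _ X :=
    ⟨hc.le _ (hX X).mem⟩
  have hw : @weakEquivalences D _ M₁.categoryWithWeakEquivalences =
      @weakEquivalences D _ M₂.categoryWithWeakEquivalences := by
    ext X Y f
    rw [@weakEquivalences_iff_of_isCofibrant D _ M₁ hX, hc,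
      @weakEquivalences_iff_of_isCofibrant D _ M₂ hX']
    simp only [hf]
  have hfib : @fibrations D _ M₁.categoryWithFibrations =
      @fibrations D _ M₂.categoryWithFibrations := by
    rw [@fibrations_eq D _ M₁, @fibrations_eq D _ M₂, hc, hw]
  obtain ⟨⟨f₁⟩, ⟨c₁⟩, ⟨w₁⟩⟩ := M₁
  obtain ⟨⟨f₂⟩, ⟨c₂⟩, ⟨w₂⟩⟩ := M₂
  obtain rfl : c₁ = c₂ := hc
  obtain rfl : w₁ = w₂ := hw
  obtain rfl : f₁ = f₂ := hfib
  rfl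

end HomotopicalAlgebra

/-! ### Pushout-products of horns with boundary inclusions and monomorphisms -/

namespace SSet

open MonoidalClosed Limits

lemma S.IsUniquelyCodimOneFace.index_op {X : SSet.{u}} {x y : X.S}
    (hxy : x.IsUniquelyCodimOneFace y) {d : ℕ} (hd : x.dim = d) :
    hxy.op.index hd = (hxy.index hd).rev := by
  obtain ⟨dx, x, rfl⟩ := x.mk_surjective
  obtain ⟨dy, y, rfl⟩ := y.mk_surjective
  obtain rfl : dy = dx + 1 := hxy.dim_eq
  obtain rfl : dx = d := hd
  refine ((S.IsUniquelyCodimOneFace.iff (X := X.op) (opObjEquiv.symm x)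
    (opObjEquiv.symm y)).1 hxy.op).unique ?_ ?_
  · exact hxy.op.δ_index rfl
  · simpa using hxy.δ_index rfl

lemma S.IsUniquelyCodimOneFace.index_eq_of_eq {X : SSet.{u}} {x y y' : X.S} (h : y = y')
    (hxy : x.IsUniquelyCodimOneFace y) (hxy' : x.IsUniquelyCodimOneFace y') {d : ℕ}
    (hd : x.dim = d) : hxy.index hd = hxy'.index hd := by
  subst h
  rfl

/-- A regular pairing presents the inclusion as a transfinite composition of pushouts of coproducts
of horns, whose indices are those of the paired faces. -/
lemma Subcomplex.Pairing.llp_rlp_ι {X : SSet.{u}} {A : X.Subcomplex} (P : A.Pairing)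
    [P.IsRegular] (J : MorphismProperty SSet.{u})
    (hJ : ∀ x : P.II, J Λ[x.1.dim + 1, (P.isUniquelyCodimOneFace x).index rfl].ι) :
    J.rlp.llp A.ι :=
  MorphismProperty.transfiniteCompositionsOfShape_le _ _ _
    ⟨P.rankFunction.relativeCellComplex.toTransfiniteCompositionOfShape, fun j hj ↦ by
      refine (?_ : (_ : MorphismProperty _) ≤ _ ) _
        (P.rankFunction.relativeCellComplex.attachCells j hj).pushouts_coproducts
      simp only [MorphismProperty.pushouts_le_iff, MorphismProperty.coproducts_le_iff]
      rintro _ _ _ ⟨c⟩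
      exact MorphismProperty.le_llp_rlp _ _ (hJ c.s)⟩

lemma Subcomplex.PairingCore.pairing_index_ne_last {X : SSet.{u}} {A : X.Subcomplex}
    (h : A.PairingCore) [h.IsProper] (hlast : ∀ s, h.index s ≠ Fin.last _)
    (x : h.pairing.II) {d : ℕ} (hd : x.1.dim = d) :
    (h.pairing.isUniquelyCodimOneFace x).index hd ≠ Fin.last _ := by
  obtain ⟨s, rfl⟩ := h.equivII.surjective x
  subst hd
  have hs : (h.pairing.isUniquelyCodimOneFace (h.equivII s)).index rfl = h.index s :=
    (S.IsUniquelyCodimOneFace.index_eq_of_eq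
      (congr_arg (fun t : h.I ↦ t.1.toS) (h.pairing_p_equivII s)) _
      (h.isUniquelyCodimOneFace s) rfl).trans (h.isUniquelyCodimOneFace_index s)
  exact fun H ↦ hlast s (hs.symm.trans H)

namespace prodStdSimplex

lemma pairingCore_index_ne_last {m : ℕ} (k : Fin (m + 1)) (n : ℕ)
    (x : (pairingCore.{u} k n).pairing.II) {d : ℕ} (hd : x.1.dim = d) :
    ((pairingCore.{u} k n).pairing.isUniquelyCodimOneFace x).index hd ≠ Fin.last _ :=
  (pairingCore.{u} k n).pairing_index_ne_last (fun s ↦ by simp [pairingCore]) x hd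

lemma leftAnodyne_unionProd_ι {m : ℕ} (k : Fin (m + 2)) (hk : k < Fin.last (m + 1)) (n : ℕ) :
    leftFibrations.{u}.llp (Subcomplex.unionProd.{u} Λ[m + 1, k] ∂Δ[n]).ι := by
  obtain ⟨k, rfl⟩ := Fin.eq_castSucc_of_ne_last (Fin.ne_last_of_lt hk)
  exact (pairingCore.{u} k n).pairing.llp_rlp_ι _ fun x ↦
    ⟨_, Fin.lt_last_iff_ne_last.2 (pairingCore_index_ne_last k n x rfl)⟩

/-- For `k` last, take the opposite of the pairing for the horn at 0: indices are reversed, so "not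
last" becomes "not zero". Otherwise the horn is inner and so are the horns of the pairing. -/
lemma rightAnodyne_unionProd_ι {m : ℕ} (k : Fin (m + 2)) (hk : 0 < k) (n : ℕ) :
    rightFibrations.{u}.llp (Subcomplex.unionProd.{u} Λ[m + 1, k] ∂Δ[n]).ι := by
  by_cases hk' : k = Fin.last (m + 1)
  · subst hk'
    have hA : (Subcomplex.unionProd.{u} Λ[m + 1, Fin.castSucc 0] ∂Δ[n]).op.preimage
        (((stdSimplex.opIso _).symm ⊗ᵢ (stdSimplex.opIso _).symm) ≪≫
          Functor.Monoidal.μIso opFunctor _ _).hom =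
        Subcomplex.unionProd.{u} Λ[m + 1, Fin.last (m + 1)] ∂Δ[n] := by
      rw [Iso.trans_hom, Subcomplex.preimage_comp, Functor.Monoidal.μIso_hom, tensorIso_hom,
        Iso.symm_hom, Iso.symm_hom, Fin.castSucc_zero, Subcomplex.preimage_op_unionProd,
        Subcomplex.preimage_unionProd, op_boundary, op_horn, Fin.rev_zero]
    refine ((pairingCore.{u} (0 : Fin (m + 1)) n).pairing.op.ofIso _ hA).llp_rlp_ι _ ?_
    rintro ⟨b, hb⟩
    refine ⟨_, Fin.pos_iff_ne_zero.2 ?_⟩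
    obtain ⟨a, rfl⟩ := (Subcomplex.N.orderIsoOfIso _ hA).symm.surjective b
    simp only [Subcomplex.Pairing.ofIso_II, Set.mem_preimage, OrderIso.apply_symm_apply] at hb
    intro h
    refine pairingCore_index_ne_last (0 : Fin (m + 1)) n ⟨_, hb⟩ rfl ?_
    have h₁ := (Subcomplex.Pairing.ofIso_index _ _ hA ⟨a, hb⟩ rfl).symm.trans h
    have h₂ := ((pairingCore.{u} (0 : Fin (m + 1)) n).pairing.isUniquelyCodimOneFace
      ⟨_, hb⟩).index_op rfl
    have h₃ := h₂.symm.trans h₁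
    rw [← Fin.rev_inj, Fin.rev_last]
    exact h₃
  · obtain ⟨k, rfl⟩ := Fin.eq_castSucc_of_ne_last hk'
    obtain ⟨k, rfl⟩ := Fin.eq_succ_of_ne_zero (i := k) (by rintro rfl; simp at hk)
    exact (pairing k.castSucc.succ n).llp_rlp_ι _ fun x ↦
      ⟨_, Fin.pos_iff_ne_zero.2 (Subcomplex.Pairing.IsInner.ne_zero x rfl)⟩

end prodStdSimplex

/-- The pushout-products of the morphisms in `J` with the boundary inclusions belong to the
saturation of `J`. -/
def IsStableUnderBoundaryPushoutProduct (J : MorphismProperty SSet.{u}) : Prop :=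
  ∀ ⦃X Y : SSet.{u}⦄ (f : X ⟶ Y), J f → ∀ (n : ℕ),
    ∃ sq : (curriedTensor SSet.{u}).PushoutObjObj f ∂Δ[n].ι, J.rlp.llp sq.ι

lemma rightHornInclusions_isStableUnderBoundaryPushoutProduct :
    IsStableUnderBoundaryPushoutProduct rightHornInclusions.{u} := by
  rintro _ _ _ ⟨k, hk⟩ n
  refine ⟨Subcomplex.unionProd.pushoutObjObj.{u} _ _, ?_⟩
  rw [Subcomplex.unionProd.pushoutObjObj_ι]
  exact prodStdSimplex.rightAnodyne_unionProd_ι k hk n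

lemma leftHornInclusions_isStableUnderBoundaryPushoutProduct :
    IsStableUnderBoundaryPushoutProduct leftHornInclusions.{u} := by
  rintro _ _ _ ⟨k, hk⟩ n
  refine ⟨Subcomplex.unionProd.pushoutObjObj.{u} _ _, ?_⟩
  rw [Subcomplex.unionProd.pushoutObjObj_ι]
  exact prodStdSimplex.leftAnodyne_unionProd_ι k hk n

namespace IsStableUnderBoundaryPushoutProduct

variable {X₁ X₂ Y₁ Y₂ E B : SSet.{u}}
  {i : X₁ ⟶ Y₁} {j : X₂ ⟶ Y₂} {p : E ⟶ B} {J : MorphismProperty SSet.{u}}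
  (hJ : IsStableUnderBoundaryPushoutProduct J)

include hJ

/-- Transposing twice exchanges the roles of `i` and of the map in `J`. Lifting against all
monomorphisms reduces to boundary inclusions, where the hypothesis on `J` applies. -/
lemma rlp_pullbackObjObjπ     [Mono i] (hp : J.rlp p)
    (sq₁₃ : MonoidalClosed.internalHom.PullbackObjObj i p) :
    J.rlp sq₁₃.π := by
  intro K L j hj
  let sq₁₂ := Functor.PushoutObjObj.ofHasPushout (curriedTensor SSet) i j
  rw [← internalHomAdjunction₂.hasLiftingProperty_iff sq₁₂]
  rw [HasLiftingProperty.iff_of_arrow_iso_left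
    (show Arrow.mk sq₁₂.ι ≅ Arrow.mk sq₁₂.flipTensor.ι from
      Arrow.isoMk (Iso.refl _) (β_ _ _))]
  let sq₁₃' := Functor.PullbackObjObj.ofHasPullback MonoidalClosed.internalHom j p
  rw [internalHomAdjunction₂.hasLiftingProperty_iff _ sq₁₃']
  suffices (MorphismProperty.monomorphisms _).rlp sq₁₃'.π from this _ inferInstance
  rw [rlp_monomorphisms]
  rintro _ _ _ ⟨n⟩
  obtain ⟨sq, hsq⟩ := hJ j hj n
  rw [← internalHomAdjunction₂.hasLiftingProperty_iff sq]
  exact hsq _ hp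

lemma llp_rlp_pushoutObjObjι  (sq₁₂ : (curriedTensor _).PushoutObjObj i j) [Mono i] (hj : J.rlp.llp j) :
    J.rlp.llp sq₁₂.ι := by
  intro E B p hp
  let sq₁₃ := Functor.PullbackObjObj.ofHasPullback MonoidalClosed.internalHom i p
  rw [internalHomAdjunction₂.hasLiftingProperty_iff _ sq₁₃]
  exact hj _ (rlp_pullbackObjObjπ hJ hp sq₁₃)

lemma llp_rlp_pushoutObjObjι' (sq₁₂ : (curriedTensor _).PushoutObjObj i j) [Mono j] (hi : J.rlp.llp i) :
    J.rlp.llp sq₁₂.ι := by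
  refine (J.rlp.llp.arrow_mk_iso_iff ?_).1
    (llp_rlp_pushoutObjObjι hJ sq₁₂.flipTensor hi)
  exact Arrow.isoMk (Iso.refl _) (β_ _ _)

end IsStableUnderBoundaryPushoutProduct

end SSet

/-! ### Local presentability of slices and of simplicial sets -/

namespace CategoryTheory.Over

open Limits Opposite

variable {C : Type v} [Category.{u} C] {S : C}

lemma mono_iff_mono_left [HasPullbacks C] {X Y : Over S} (f : X ⟶ Y) : Mono f ↔ Mono f.left :=
  ⟨fun _ ↦ inferInstance, fun _ ↦ mono_of_mono_left f⟩

lemma isCardinalPresentable [HasColimitsOfSize.{u, u} C] (κ : Cardinal.{u}) [Fact κ.IsRegular]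
    (Y : Over S) [IsCardinalPresentable Y.left κ] : IsCardinalPresentable Y κ where
  preservesColimitOfShape J _ _ := ⟨fun {F} ↦ ⟨fun {c} hc ↦ ⟨by
    have : IsFiltered J := isFiltered_of_isCardinalFiltered J κ
    have hc' := isColimitOfPreserves (Over.forget S) hc
    refine Types.FilteredColimit.isColimitOf' _ _ (fun (f : Y ⟶ c.pt) ↦ ?_)
      (fun i (f : Y ⟶ F.obj i) (g : Y ⟶ F.obj i) hfg ↦ ?_)
    · obtain ⟨j, (g : Y.left ⟶ (F.obj j).left), hg⟩ :=
        IsCardinalPresentable.exists_hom_of_isColimit κ hc' (X := Y.left) f.left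
      replace hg : g ≫ (c.ι.app j).left = f.left := hg
      refine ⟨j, Over.homMk g ?_, ?_⟩
      · rw [← Over.w (c.ι.app j), reassoc_of% hg]
        exact Over.w f
      · apply Over.OverMorphism.ext
        exact hg.symm
    · obtain ⟨j, a, ha⟩ := IsCardinalPresentable.exists_eq_of_isColimit' κ hc'
        (X := Y.left) f.left g.left (congr_arg CommaMorphism.left hfg)
      refine ⟨j, a, ?_⟩
      apply Over.OverMorphism.ext
      exact ha⟩⟩⟩

instance isCardinalLocallyPresentable (κ : Cardinal.{u}) [Fact κ.IsRegular]
    [IsCardinalLocallyPresentable C κ] [HasPullbacks C] :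
    IsCardinalLocallyPresentable (Over S) κ := by
  obtain ⟨P, _, hP, hP'⟩ := (IsCardinalLocallyPresentable.iff_exists_isStrongGenerator C κ).1
    inferInstance
  rw [ObjectProperty.isStrongGenerator_iff] at hP
  obtain ⟨h₁, h₂⟩ := hP
  rw [IsCardinalLocallyPresentable.iff_exists_isStrongGenerator]
  let Q : ObjectProperty (Over S) :=
    ObjectProperty.ofObj (fun (x : Σ G : Subtype P, G.1 ⟶ S) ↦ Over.mk x.2)
  have hQ {G : C} (hG : P G) (g : G ⟶ S) : Q (Over.mk g) :=
    ObjectProperty.ofObj_apply _ (⟨⟨G, hG⟩, g⟩ : Σ G : Subtype P, G.1 ⟶ S)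
  refine ⟨Q, inferInstance, ?_, ?_⟩
  · rw [ObjectProperty.isStrongGenerator_iff]
    refine ⟨fun X Y f g h ↦ Over.OverMorphism.ext (h₁ _ _ fun G hG x ↦ ?_), fun X Y i _ h ↦ ?_⟩
    · exact congr_arg CommaMorphism.left (h _ (hQ hG (x ≫ X.hom)) (Over.homMk x))
    · have : IsIso i.left := h₂ _ (fun G hG x ↦ by
        obtain ⟨y, hy⟩ := h _ (hQ hG (x ≫ Y.hom)) (Over.homMk x)
        exact ⟨y.left, congr_arg CommaMorphism.left hy⟩)
      have : IsIso ((Over.forget S).map i) := this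
      exact isIso_of_reflects_iso i (Over.forget S)
  · rintro _ ⟨G, g⟩
    have : IsCardinalPresentable G.1 κ := hP' _ G.2
    have : IsCardinalPresentable (Over.mk g).left κ := this
    exact isCardinalPresentable κ _

instance [HasInitial C] [HasStrictInitialObjects C] : HasStrictInitialObjects (Over S) where
  out {I X} f hI := by
    have hI' : IsInitial I.left := (IsInitial.isInitialObj (Over.forget S) _ hI :)
    have : IsIso ((Over.forget S).map f) := hI'.isIso_to f.left
    exact isIso_of_reflects_iso f (Over.forget S)

end CategoryTheory.Over

namespace SSet

open Limits Opposite

attribute [local instance] Cardinal.fact_isRegular_aleph0 in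
instance isCardinalLocallyPresentable (κ : Cardinal.{u}) [Fact κ.IsRegular] :
    IsCardinalLocallyPresentable SSet.{u} κ := by
  rw [IsCardinalLocallyPresentable.iff_exists_isStrongGenerator]
  let Q : ObjectProperty SSet.{u} := ObjectProperty.ofObj (fun n : ULift.{u} ℕ ↦ Δ[n.down])
  have hQ (n : ℕ) : Q Δ[n] := ObjectProperty.ofObj_apply (fun n : ULift.{u} ℕ ↦ Δ[n.down]) ⟨n⟩
  refine ⟨Q, inferInstance, ?_, ?_⟩
  · rw [ObjectProperty.isStrongGenerator_iff]
    refine ⟨fun X Y f g h ↦ ?_, fun X Y i _ h ↦ ?_⟩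
    · ext ⟨n⟩ x
      induction n using SimplexCategory.rec with | _ n
      have := congr_arg yonedaEquiv (h _ (hQ n) (yonedaEquiv.symm x))
      simpa [yonedaEquiv_comp] using this
    · have (n : SimplexCategoryᵒᵖ) : IsIso (i.app n) := by
        rw [isIso_iff_bijective]
        refine ⟨(mono_iff_injective _).1 inferInstance, fun y ↦ ?_⟩
        induction n using Opposite.rec with | _ n
        induction n using SimplexCategory.rec with | _ n
        obtain ⟨x, hx⟩ := h _ (hQ n) (yonedaEquiv.symm y)
        refine ⟨yonedaEquiv x, ?_⟩
        exact (yonedaEquiv_comp x i).symm.trans (yonedaEquiv.symm_apply_eq.1 hx.symm).symm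
      exact NatIso.isIso_of_isIso_app i
  · rintro _ ⟨n⟩
    exact isCardinalPresentable_of_le (κ := Cardinal.aleph0.{u}) (Δ[n.down] : SSet.{u})
      (Cardinal.IsRegular.aleph0_le Fact.out)

end SSet

/-! ### Lifting and extending homotopies of simplicial sets -/

namespace SSet

open MonoidalClosed Limits

lemma mono_coprod_desc {X Y Z : SSet.{u}} (f : X ⟶ Z) (g : Y ⟶ Z) [Mono f] [Mono g]
    (h : ∀ n (x : X.obj n) (y : Y.obj n), f.app n x ≠ g.app n y) :
    Mono (coprod.desc f g) := by
  have (n : SimplexCategoryᵒᵖ) : Mono ((coprod.desc f g).app n) := by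
    rw [mono_iff_injective]
    let F : SSet.{u} ⥤ Type u := (CategoryTheory.evaluation _ _).obj n
    have hc := mapIsColimitOfPreservesOfIsColimit F _ _ (coprodIsCoprod X Y)
    have hc' := (Types.binaryCofan_isColimit_iff _).1 ⟨hc⟩
    have hsurj (z : (X ⨿ Y : SSet.{u}).obj n) :
        (∃ x, (coprod.inl : X ⟶ X ⨿ Y).app n x = z) ∨
          ∃ y, (coprod.inr : Y ⟶ X ⨿ Y).app n y = z := by
      have := hc'.2.2.sup_eq_top.ge (Set.mem_univ z)
      exact this
    have hl (x : X.obj n) : (coprod.desc f g).app n ((coprod.inl : X ⟶ X ⨿ Y).app n x) =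
        f.app n x := by
      rw [← NatTrans.comp_app_apply, coprod.inl_desc]
    have hr (y : Y.obj n) : (coprod.desc f g).app n ((coprod.inr : Y ⟶ X ⨿ Y).app n y) =
        g.app n y := by
      rw [← NatTrans.comp_app_apply, coprod.inr_desc]
    have hf : Function.Injective (f.app n) := (mono_iff_injective _).1 inferInstance
    have hg : Function.Injective (g.app n) := (mono_iff_injective _).1 inferInstance
    intro z z' hz
    obtain ⟨x, rfl⟩ | ⟨x, rfl⟩ := hsurj z <;> obtain ⟨y, rfl⟩ | ⟨y, rfl⟩ := hsurj z' <;>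
      simp only [hl, hr] at hz
    · rw [hf hz]
    · exact (h _ _ _ hz).elim
    · exact (h _ _ _ hz.symm).elim
    · rw [hg hz]
  exact NatTrans.mono_of_mono_app _

/-- The vertex `Δ[0] ⟶ Δ[1]` corresponding to `e : Fin 2`. -/
noncomputable def vertex (e : Fin 2) : (Δ[0] : SSet.{u}) ⟶ Δ[1] :=
  const (stdSimplex.obj₀Equiv.{u}.symm e)

lemma vertex_app_apply (e : Fin 2) {n : ℕ} (x : Δ[0] _⦋n⦌) (i : Fin (n + 1)) :
    ((vertex.{u} e).app _ x : Δ[1] _⦋n⦌) i = e := rfl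

instance (e : Fin 2) : Mono (vertex.{u} e) := ⟨fun _ _ _ ↦ stdSimplex.ext₀⟩

lemma mono_coprod_desc_vertex {e e' : Fin 2} (h : e ≠ e') :
    Mono (coprod.desc (vertex.{u} e) (vertex e')) :=
  mono_coprod_desc _ _ (fun n x y hxy ↦ by
    induction n using Opposite.rec with | _ n
    induction n using SimplexCategory.rec with | _ n
    have h' := congr_arg (fun (z : Δ[1] _⦋n⦌) ↦ z 0) hxy
    simp only [vertex_app_apply] at h'
    exact h h')

/-- The inclusion `X ⟶ X ⊗ Δ[1]` corresponding to `e : Fin 2`. -/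
noncomputable def cylinderEnd (e : Fin 2) (X : SSet.{u}) : X ⟶ X ⊗ Δ[1] :=
  lift (𝟙 X) (const (stdSimplex.obj₀Equiv.{u}.symm e))

lemma cylinderEnd_fst (e : Fin 2) (X : SSet.{u}) : cylinderEnd e X ≫ fst X Δ[1] = 𝟙 X := rfl

lemma cylinderEnd_fst_assoc (e : Fin 2) (X : SSet.{u}) {Z : SSet.{u}} (f : X ⟶ Z) :
    cylinderEnd e X ≫ fst X Δ[1] ≫ f = f := rfl

lemma cylinderEnd_whiskerRight (e : Fin 2) {X Y : SSet.{u}} (f : X ⟶ Y) :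
    cylinderEnd e X ≫ f ▷ Δ[1] = f ≫ cylinderEnd e Y := rfl

lemma cylinderEnd_app_snd_apply (e : Fin 2) {X : SSet.{u}} {n : ℕ} (x : X _⦋n⦌)
    (i : Fin (n + 1)) :
    (((cylinderEnd e X).app _ x : (X ⊗ Δ[1] : SSet.{u}) _⦋n⦌).2 : Δ[1] _⦋n⦌) i = e := rfl

instance (e : Fin 2) (X : SSet.{u}) : Mono (cylinderEnd e X) :=
  mono_of_mono_fac (cylinderEnd_fst e X)

lemma mono_coprod_desc_cylinderEnd {e e' : Fin 2} (h : e ≠ e') (X : SSet.{u}) :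
    Mono (coprod.desc (cylinderEnd e X) (cylinderEnd e' X)) :=
  mono_coprod_desc _ _ (fun n x y hxy ↦ by
    induction n using Opposite.rec with | _ n
    induction n using SimplexCategory.rec with | _ n
    have h' := congr_arg (fun (z : (X ⊗ Δ[1] : SSet.{u}) _⦋n⦌) ↦ (z.2 : Δ[1] _⦋n⦌) 0) hxy
    simp only [cylinderEnd_app_snd_apply] at h'
    exact h h')

lemma whiskerLeft_vertex (X : SSet.{u}) (e : Fin 2) :
    X ◁ vertex e = fst X Δ[0] ≫ cylinderEnd e X := rfl

/-- The horn `Λ[1, e]` omits the vertex other than `e`, so it is reduced to the vertex `e`. -/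
lemma horn_one_toΔ₀_vertex (e : Fin 2) (f : (Λ[1, e] : SSet.{u}) ⟶ Δ[0]) :
    f ≫ vertex e = Λ[1, e].ι := by
  ext ⟨n⟩ ⟨x, hx'⟩
  induction n using SimplexCategory.rec with | _ n
  obtain ⟨j, hj, hx⟩ := (mem_horn_iff_notMem_range _ _).1 hx'
  refine stdSimplex.ext _ _ fun i ↦ ?_
  have hi : x i ≠ j := fun h ↦ hx ⟨i, h⟩
  have h₁ : ((f ≫ vertex e).app _ ⟨x, hx'⟩ : Δ[1] _⦋n⦌) i = e := rfl
  have h₂ : (Λ[1, e].ι.app _ ⟨x, hx'⟩ : Δ[1] _⦋n⦌) i = x i := rfl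
  refine h₁.trans (Eq.trans ?_ h₂.symm)
  omega

lemma llp_rlp_vertex (J : MorphismProperty SSet.{u}) (e : Fin 2) (he : J Λ[1, e].ι) :
    J.rlp.llp (vertex e) := by
  let f : (Λ[1, e] : SSet.{u}) ⟶ Δ[0] := stdSimplex.isTerminalObj₀.from _
  have hf : f ≫ vertex e = Λ[1, e].ι := horn_one_toΔ₀_vertex e f
  let g : Δ[0] ⟶ (Λ[1, e] : SSet.{u}) := Subcomplex.lift (vertex e) (by
    rintro ⟨n⟩ _ ⟨x, rfl⟩
    induction n using SimplexCategory.rec with | _ n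
    rw [mem_horn_iff_notMem_range]
    obtain ⟨j, hj⟩ := exists_ne e
    refine ⟨j, hj, ?_⟩
    rintro ⟨i, hi⟩
    rw [vertex_app_apply] at hi
    exact hj hi.symm)
  have hg : g ≫ Λ[1, e].ι = vertex e := rfl
  let α : Arrow.mk Λ[1, e].ι ≅ Arrow.mk (vertex.{u} e) :=
    Arrow.isoMk { hom := f, inv := g, hom_inv_id := by rw [← cancel_mono Λ[1, e].ι]; simp [hf, hg], inv_hom_id := stdSimplex.ext₀ } (Iso.refl _) (by simpa using! hf)
  exact (J.rlp.llp.arrow_mk_iso_iff α).1 (MorphismProperty.le_llp_rlp _ _ he)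

namespace IsStableUnderBoundaryPushoutProduct

variable {J : MorphismProperty SSet.{u}} (hJ : IsStableUnderBoundaryPushoutProduct J)

include hJ

/-- Apply the pushout-product of `k` with the vertex `e`, which is a horn inclusion in `J` up to
isomorphism. -/
lemma exists_lift {K L E B : SSet.{u}} (e : Fin 2) (he : J Λ[1, e].ι)
    (k : K ⟶ L) [Mono k] (p : E ⟶ B) (hp : J.rlp p)
    (a : K ⊗ Δ[1] ⟶ E) (b : L ⟶ E) (β : L ⊗ Δ[1] ⟶ B)
    (hab : cylinderEnd e K ≫ a = k ≫ b) (haβ : a ≫ p = k ▷ Δ[1] ≫ β)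
    (hbβ : b ≫ p = cylinderEnd e L ≫ β) :
    ∃ γ : L ⊗ Δ[1] ⟶ E, k ▷ Δ[1] ≫ γ = a ∧ cylinderEnd e L ≫ γ = b ∧ γ ≫ p = β := by
  let sq := Functor.PushoutObjObj.ofHasPushout (curriedTensor SSet.{u}) k (vertex e)
  have hsq : J.rlp.llp sq.ι := hJ.llp_rlp_pushoutObjObjι sq (llp_rlp_vertex J e he)
  have := hsq p hp
  let t : sq.pt ⟶ E := sq.isPushout.desc (fst L Δ[0] ≫ b : L ⊗ Δ[0] ⟶ E) a (by
    have h : k ▷ Δ[0] ≫ fst L Δ[0] ≫ b = K ◁ vertex e ≫ a := by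
      rw [whiskerLeft_vertex, Category.assoc, hab, whiskerRight_fst_assoc]
    exact h)
  have ht₁ : sq.inl ≫ t = fst L Δ[0] ≫ b := sq.isPushout.inl_desc _ _ _
  have ht₂ : sq.inr ≫ t = a := sq.isPushout.inr_desc _ _ _
  have hι₁ : sq.inl ≫ sq.ι = L ◁ vertex e := sq.inl_ι
  have hι₂ : sq.inr ≫ sq.ι = k ▷ Δ[1] := sq.inr_ι
  have w : CommSq t sq.ι p β := ⟨by
    apply sq.isPushout.hom_ext
    · rw [reassoc_of% ht₁, reassoc_of% hι₁, whiskerLeft_vertex, Category.assoc, hbβ]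
    · rw [reassoc_of% ht₂, reassoc_of% hι₂, haβ]⟩
  refine ⟨w.lift, ?_, ?_, w.fac_right⟩
  · rw [← hι₂, Category.assoc, w.fac_left, ht₂]
  · have h : L ◁ vertex e ≫ w.lift = fst L Δ[0] ≫ b := by
      rw [← hι₁, Category.assoc, w.fac_left, ht₁]
    have h' := congr_arg (fun φ ↦ lift (𝟙 L) (stdSimplex.isTerminalObj₀.from L) ≫ φ) h
    simpa [whiskerLeft_vertex] using h'

/-- Apply the pushout-product of `k` with the monomorphism `Δ[0] ⨿ Δ[0] ⟶ Δ[1]`. The map `p` and the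
base homotopy `β` make the result usable over `A`. -/
lemma exists_extension {K L W B : SSet.{u}} {e e' : Fin 2} (he : e ≠ e')
    (k : K ⟶ L) (hk : J k) (p : W ⟶ B) (hp : J.rlp p) (h : K ⊗ Δ[1] ⟶ W) (f g : L ⟶ W) (β : L ⊗ Δ[1] ⟶ B)
    (hf : cylinderEnd e K ≫ h = k ≫ f) (hg : cylinderEnd e' K ≫ h = k ≫ g) (hβ : h ≫ p = k ▷ Δ[1] ≫ β)
    (hfβ : f ≫ p = cylinderEnd e L ≫ β) (hgβ : g ≫ p = cylinderEnd e' L ≫ β) :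
    ∃ H : L ⊗ Δ[1] ⟶ W, k ▷ Δ[1] ≫ H = h ∧ cylinderEnd e L ≫ H = f ∧
      cylinderEnd e' L ≫ H = g ∧ H ≫ p = β := by
  let j : (Δ[0] ⨿ Δ[0] : SSet.{u}) ⟶ Δ[1] := coprod.desc (vertex e) (vertex e')
  let sq := Functor.PushoutObjObj.ofHasPushout (curriedTensor SSet.{u}) k j
  have : Mono j := mono_coprod_desc_vertex he
  have hsq : J.rlp.llp sq.ι := hJ.llp_rlp_pushoutObjObjι' sq
    (MorphismProperty.le_llp_rlp _ _ hk)
  have := hsq p hp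
  have hext {X Y : SSet.{u}} {a b : X ⊗ (Δ[0] ⨿ Δ[0] : SSet.{u}) ⟶ Y}
      (h₁ : X ◁ coprod.inl ≫ a = X ◁ coprod.inl ≫ b)
      (h₂ : X ◁ coprod.inr ≫ a = X ◁ coprod.inr ≫ b) : a = b := by
    apply MonoidalClosed.curry_injective
    apply coprod.hom_ext
    · rw [← MonoidalClosed.curry_natural_left, h₁, MonoidalClosed.curry_natural_left]
    · rw [← MonoidalClosed.curry_natural_left, h₂, MonoidalClosed.curry_natural_left]
  have hj₀ (X : SSet.{u}) : X ◁ coprod.inl ≫ X ◁ j = fst X Δ[0] ≫ cylinderEnd e X := by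
    rw [← MonoidalCategory.whiskerLeft_comp, coprod.inl_desc]
    rfl
  have hj₁ (X : SSet.{u}) : X ◁ coprod.inr ≫ X ◁ j = fst X Δ[0] ≫ cylinderEnd e' X := by
    rw [← MonoidalCategory.whiskerLeft_comp, coprod.inr_desc]
    rfl
  let φ : L ⊗ (Δ[0] ⨿ Δ[0] : SSet.{u}) ⟶ W := MonoidalClosed.uncurry
    (coprod.desc (MonoidalClosed.curry (fst L Δ[0] ≫ f)) (MonoidalClosed.curry (fst L Δ[0] ≫ g)))
  have hφ₀ : L ◁ coprod.inl ≫ φ = fst L Δ[0] ≫ f := by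
    rw [← MonoidalClosed.uncurry_natural_left, coprod.inl_desc, MonoidalClosed.uncurry_curry]
  have hφ₁ : L ◁ coprod.inr ≫ φ = fst L Δ[0] ≫ g := by
    rw [← MonoidalClosed.uncurry_natural_left, coprod.inr_desc, MonoidalClosed.uncurry_curry]
  have hφ : k ▷ (Δ[0] ⨿ Δ[0] : SSet.{u}) ≫ φ = K ◁ j ≫ h := by
    apply hext
    · rw [whisker_exchange_assoc, hφ₀, whiskerRight_fst_assoc, reassoc_of% (hj₀ K), hf]
    · rw [whisker_exchange_assoc, hφ₁, whiskerRight_fst_assoc, reassoc_of% (hj₁ K), hg]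
  let t : sq.pt ⟶ W := sq.isPushout.desc φ h hφ
  have ht₁ : sq.inl ≫ t = φ := sq.isPushout.inl_desc _ _ _
  have ht₂ : sq.inr ≫ t = h := sq.isPushout.inr_desc _ _ _
  have hι₁ : sq.inl ≫ sq.ι = L ◁ j := sq.inl_ι
  have hι₂ : sq.inr ≫ sq.ι = k ▷ Δ[1] := sq.inr_ι
  have w : CommSq t sq.ι p β := ⟨by
    apply sq.isPushout.hom_ext
    · rw [reassoc_of% ht₁, reassoc_of% hι₁]
      apply hext
      · rw [reassoc_of% hφ₀, reassoc_of% (hj₀ L), hfβ]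
      · rw [reassoc_of% hφ₁, reassoc_of% (hj₁ L), hgβ]
    · rw [reassoc_of% ht₂, reassoc_of% hι₂, hβ]⟩
  have hl : L ◁ j ≫ w.lift = φ := by
    rw [← hι₁, Category.assoc, w.fac_left, ht₁]
  refine ⟨w.lift, ?_, ?_, ?_, w.fac_right⟩
  · rw [← hι₂, Category.assoc, w.fac_left, ht₂]
  · have h' : fst L Δ[0] ≫ cylinderEnd e L ≫ w.lift = fst L Δ[0] ≫ f := by
      rw [← hφ₀, ← hl, reassoc_of% (hj₀ L)]
    simpa using congr_arg (fun φ ↦ lift (𝟙 L) (stdSimplex.isTerminalObj₀.from L) ≫ φ) h'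
  · have h' : fst L Δ[0] ≫ cylinderEnd e' L ≫ w.lift = fst L Δ[0] ≫ g := by
      rw [← hφ₁, ← hl, reassoc_of% (hj₁ L)]
    simpa using congr_arg (fun φ ↦ lift (𝟙 L) (stdSimplex.isTerminalObj₀.from L) ≫ φ) h'

end IsStableUnderBoundaryPushoutProduct

end SSet

/-! ### The cylinder on a slice and its right adjoint -/

namespace CategoryTheory.Over

open Limits

variable {C : Type v} [Category.{u} C]

lemma mono_coprod_desc [HasPullbacks C] [HasBinaryCoproducts C] {S : C} {X Y Z : Over S}
    (f : X ⟶ Z) (g : Y ⟶ Z) [Mono (coprod.desc f.left g.left)] :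
    Mono (coprod.desc f g) := by
  have h : coprodComparison (Over.forget S) X Y ≫ (Over.forget S).map (coprod.desc f g) =
      coprod.desc ((Over.forget S).map f) ((Over.forget S).map g) := by
    apply coprod.hom_ext
    · rw [coprodComparison_inl_assoc, ← Functor.map_comp, coprod.inl_desc, coprod.inl_desc]
    · rw [coprodComparison_inr_assoc, ← Functor.map_comp, coprod.inr_desc, coprod.inr_desc]
  have : Mono (coprod.desc ((Over.forget S).map f) ((Over.forget S).map g)) :=
    inferInstanceAs (Mono (coprod.desc f.left g.left))
  refine @Over.mono_of_mono_left _ _ _ _ _ _ ?_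
  change Mono ((Over.forget S).map (coprod.desc f g))
  rw [← IsIso.eq_inv_comp] at h
  rw [h]
  infer_instance

variable [CartesianMonoidalCategory C] [BraidedCategory C] (I S : C)

/-- The endofunctor of `Over S` which sends `X ⟶ S` to `X ⊗ I ⟶ X ⟶ S`. -/
def tensorRight : Over S ⥤ Over S where
  obj X := Over.mk (fst X.left I ≫ X.hom)
  map f := Over.homMk (f.left ▷ I) (by
    dsimp
    rw [whiskerRight_fst_assoc, Over.w])
  map_id X := by
    apply Over.OverMorphism.ext
    simp
  map_comp f g := by
    apply Over.OverMorphism.ext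
    simp

variable {S} in
lemma tensorRight_map_left {X Y : Over S} (f : X ⟶ Y) :
    ((tensorRight I S).map f).left = f.left ▷ I := rfl

variable [Closed I] {I S}

/-- Being a homotopy over `S` means, after transposition, that the path in `S` is constant; this is
the condition defining the pullback `path`. -/
lemma comp_eq_fst_comp_iff {X W : C} (h : X ⊗ I ⟶ W) (p : W ⟶ S) (f : X ⟶ S) :
    h ≫ p = fst X I ≫ f ↔
      MonoidalClosed.curry ((β_ I X).hom ≫ h) ≫ (ihom I).map p =
        f ≫ MonoidalClosed.curry (snd I S) := by
  rw [← MonoidalClosed.curry_natural_right, ← MonoidalClosed.curry_natural_left,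
    MonoidalClosed.curry_injective.eq_iff, whiskerLeft_snd, Category.assoc,
    ← Iso.eq_inv_comp, braiding_inv_snd_assoc]

variable [HasPullbacks C]

variable (I) in
/-- The object part of the right adjoint of `tensorRight I S`. -/
noncomputable def path (W : Over S) : Over S :=
  Over.mk (pullback.snd ((ihom I).map W.hom) (MonoidalClosed.curry (snd I S)))

lemma path_hom_ext {X W : Over S} {f g : X ⟶ path I W}
    (h : f.left ≫ pullback.fst ((ihom I).map W.hom) (MonoidalClosed.curry (snd I S)) =
      g.left ≫ pullback.fst ((ihom I).map W.hom) (MonoidalClosed.curry (snd I S))) :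
    f = g :=
  Over.OverMorphism.ext (pullback.hom_ext h ((Over.w f).trans (Over.w g).symm))

/-- The adjunction bijection between `tensorRight I S` and `path I`. -/
noncomputable def tensorRightHomEquiv (X W : Over S) :
    ((tensorRight I S).obj X ⟶ W) ≃ (X ⟶ path I W) where
  toFun h := Over.homMk (pullback.lift (MonoidalClosed.curry ((β_ I X.left).hom ≫ h.left))
      X.hom ((comp_eq_fst_comp_iff (X := X.left) h.left W.hom X.hom).1 (Over.w h)))
    (pullback.lift_snd _ _ _)
  invFun g := Over.homMk ((β_ I X.left).inv ≫
      MonoidalClosed.uncurry (g.left ≫ pullback.fst _ _))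
    ((comp_eq_fst_comp_iff ((β_ I X.left).inv ≫ MonoidalClosed.uncurry
      (g.left ≫ pullback.fst ((ihom I).map W.hom) (MonoidalClosed.curry (snd I S))))
      W.hom X.hom).2 (by
      have hw : g.left ≫ pullback.snd _ _ = X.hom := Over.w g
      rw [Iso.hom_inv_id_assoc, MonoidalClosed.curry_uncurry, ← hw]
      exact (Category.assoc _ _ _).trans
        ((congr_arg (g.left ≫ ·) pullback.condition).trans (Category.assoc _ _ _).symm)))
  left_inv h := by
    apply Over.OverMorphism.ext
    refine (congr_arg (fun t ↦ (β_ I X.left).inv ≫ MonoidalClosed.uncurry t)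
      (pullback.lift_fst _ _ _)).trans ?_
    rw [MonoidalClosed.uncurry_curry]
    exact Iso.inv_hom_id_assoc _ _
  right_inv g := by
    apply path_hom_ext
    exact (pullback.lift_fst _ _ _).trans ((congr_arg MonoidalClosed.curry
      (Iso.hom_inv_id_assoc (β_ I X.left) _)).trans (MonoidalClosed.curry_uncurry _))

lemma tensorRightHomEquiv_apply_left_fst {X W : Over S} (h : (tensorRight I S).obj X ⟶ W) :
    (tensorRightHomEquiv X W h).left ≫
      pullback.fst ((ihom I).map W.hom) (MonoidalClosed.curry (snd I S)) =
        MonoidalClosed.curry ((β_ I X.left).hom ≫ h.left) :=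
  pullback.lift_fst _ _ _

instance : (tensorRight I S).IsLeftAdjoint :=
  (Adjunction.adjunctionOfEquivRight tensorRightHomEquiv (fun X' X W f g ↦ by
    apply path_hom_ext
    rw [tensorRightHomEquiv_apply_left_fst, Over.comp_left, Over.comp_left,
      tensorRight_map_left]
    refine Eq.trans ?_ (Category.assoc _ _ _).symm
    rw [tensorRightHomEquiv_apply_left_fst, ← MonoidalClosed.curry_natural_left]
    exact congr_arg _ (BraidedCategory.braiding_naturality_right_assoc _ _ _).symm)).isLeftAdjoint

end CategoryTheory.Over

namespace SSet

open Limits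

/-- The inclusion of the end of the cylinder corresponding to `e : Fin 2`. -/
noncomputable def overCylinderEnd {A : SSet.{u}} (e : Fin 2) (X : Over A) :
    X ⟶ (Over.tensorRight Δ[1] A).obj X :=
  Over.homMk (cylinderEnd e X.left) (cylinderEnd_fst_assoc _ _ _)

/-- The cylinder on `Over A` whose second end is at the vertex `e` of `Δ[1]`. -/
noncomputable def overCylinder (A : SSet.{u}) (e : Fin 2) : HomotopyCylinder (Over A) where
  cyl := Over.tensorRight Δ[1] A
  i₀ := overCylinderEnd e.rev
  i₁ := overCylinderEnd e
  pr X := Over.homMk (fst X.left Δ[1]) rfl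
  i₀_naturality f := Over.OverMorphism.ext (cylinderEnd_whiskerRight _ _)
  i₁_naturality f := Over.OverMorphism.ext (cylinderEnd_whiskerRight _ _)
  pr_naturality f := Over.OverMorphism.ext (whiskerRight_fst _ _)
  i₀_pr X := Over.OverMorphism.ext (cylinderEnd_fst _ _)
  i₁_pr X := Over.OverMorphism.ext (cylinderEnd_fst _ _)
  mono_i X :=
    have : Mono (coprod.desc (overCylinderEnd e.rev X).left (overCylinderEnd e X).left) :=
      mono_coprod_desc_cylinderEnd (show e.rev ≠ e by decide +revert) X.left
    Over.mono_coprod_desc (overCylinderEnd e.rev X) (overCylinderEnd e X)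

end SSet

/-! ### Lifting properties in slices and the anodyne structure over `A` -/

namespace CategoryTheory.Over

open Limits

variable {C : Type v} [Category.{u} C] {ι : Type u} {K L : ι → C} (s : ∀ i, K i ⟶ L i) (S : C)

/-- The family of morphisms in `Over S` which are sent to the family `s` by the
forgetful functor. -/
def overFamily (x : Σ i, L i ⟶ S) : Over.mk (s x.1 ≫ x.2) ⟶ Over.mk x.2 :=
  Over.homMk (s x.1)

variable {S} in
lemma hasLiftingProperty_of_left {X Y Z T : Over S} (f : X ⟶ Y) (p : Z ⟶ T)
    [HasLiftingProperty f.left p.left] : HasLiftingProperty f p where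
  sq_hasLift {a b} sq := by
    have sq' : CommSq a.left f.left p.left b.left := ⟨congr_arg CommaMorphism.left sq.w⟩
    exact ⟨⟨Over.homMk sq'.lift (by rw [← Over.w p, sq'.fac_right_assoc, Over.w b]),
      Over.OverMorphism.ext sq'.fac_left, Over.OverMorphism.ext sq'.fac_right⟩⟩

variable {S} in
lemma rlp_ofHoms_overFamily_iff {Z T : Over S} (p : Z ⟶ T) :
    (MorphismProperty.ofHoms (overFamily s S)).rlp p ↔
      (MorphismProperty.ofHoms s).rlp p.left := by
  constructor
  · rintro h _ _ _ ⟨i⟩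
    refine ⟨fun {a b} sq ↦ ?_⟩
    have : HasLiftingProperty (overFamily s S ⟨i, b ≫ T.hom⟩) p := h _ ⟨_⟩
    let a' : Over.mk (s i ≫ b ≫ T.hom) ⟶ Z := Over.homMk a (by
      have := sq.w
      dsimp
      rw [← Over.w p, reassoc_of% this])
    let b' : Over.mk (b ≫ T.hom) ⟶ T := Over.homMk b rfl
    have sq' : CommSq a' (overFamily s S ⟨i, b ≫ T.hom⟩) p b' := ⟨Over.OverMorphism.ext sq.w⟩
    exact ⟨⟨sq'.lift.left, congr_arg CommaMorphism.left sq'.fac_left,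
      congr_arg CommaMorphism.left sq'.fac_right⟩⟩
  · rintro h _ _ _ ⟨x⟩
    have : HasLiftingProperty (overFamily s S x).left p.left :=
      h _ ⟨_⟩
    exact hasLiftingProperty_of_left _ _

variable {S} in
lemma rlp_ofHoms_overFamily_terminal_iff [HasTerminal (Over S)] (X : Over S) :
    (MorphismProperty.ofHoms (overFamily s S)).rlp (terminal.from X) ↔
      (MorphismProperty.ofHoms s).rlp X.hom := by
  rw [rlp_ofHoms_overFamily_iff, ← Over.w (terminal.from X)]
  have : IsIso (⊤_ (Over S)).hom := by
    let e := terminalIsTerminal.uniqueUpToIso (Over.mkIdTerminal (X := S))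
    have : e.hom.left = (⊤_ (Over S)).hom := by simpa using Over.w e.hom
    rw [← this]
    exact inferInstanceAs (IsIso ((Over.forget S).map e.hom))
  exact (MorphismProperty.cancel_right_of_respectsIso _ _ _).symm

end CategoryTheory.Over

namespace SSet

open Limits

lemma _root_.Fin.rev_ne_self (e : Fin 2) : e.rev ≠ e := by
  decide +revert

/-- The boundary inclusions, indexed by a type in the universe `u`. -/
noncomputable def boundaryFamily (n : ULift.{u} ℕ) : (∂Δ[n.down] : SSet.{u}) ⟶ Δ[n.down] :=
  ∂Δ[n.down].ι

lemma ofHoms_boundaryFamily_rlp :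
    (MorphismProperty.ofHoms boundaryFamily.{u}).rlp =
      (MorphismProperty.monomorphisms SSet.{u}).rlp := by
  rw [rlp_monomorphisms]
  ext X Y p
  refine ⟨fun h ↦ ?_, fun h ↦ ?_⟩
  · rintro _ _ _ ⟨n⟩
    exact h _ (.mk (ULift.up n))
  · rintro _ _ _ ⟨n⟩
    exact h _ (.mk n.down)

attribute [local instance] Cardinal.fact_isRegular_aleph0 in
lemma exists_mono_fac {X Y : SSet.{u}} (f : X ⟶ Y) :
    ∃ (Z : SSet.{u}) (i : X ⟶ Z) (p : Z ⟶ Y), Mono i ∧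
      (MorphismProperty.monomorphisms SSet.{u}).rlp p ∧ i ≫ p = f := by
  have : IsLocallyPresentable.{u} SSet.{u} := ⟨Cardinal.aleph0, inferInstance, inferInstance⟩
  have : MorphismProperty.IsSmall.{u} (MorphismProperty.ofHoms boundaryFamily.{u}) :=
    MorphismProperty.isSmall_ofHoms ..
  have := MorphismProperty.hasSmallObjectArgument_of_isLocallyPresentable
    (MorphismProperty.ofHoms boundaryFamily.{u})
  have hI : (MorphismProperty.ofHoms boundaryFamily.{u}).rlp.llp ≤
      MorphismProperty.monomorphisms _ := by
    rw [MorphismProperty.llp_rlp_of_hasSmallObjectArgument]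
    simp only [MorphismProperty.retracts_le_iff, MorphismProperty.transfiniteCompositions_le_iff,
      MorphismProperty.pushouts_le_iff]
    refine (MorphismProperty.coproducts_le_iff.{u}).2 ?_
    rintro _ _ _ ⟨n⟩
    exact inferInstanceAs (Mono ∂Δ[n.down].ι)
  let d := MorphismProperty.factorizationData (MorphismProperty.ofHoms boundaryFamily.{u}).rlp.llp
    (MorphismProperty.ofHoms boundaryFamily.{u}).rlp f
  exact ⟨_, d.i, d.p, hI _ d.hi, by rw [← ofHoms_boundaryFamily_rlp]; exact d.hp, d.fac⟩

variable (A : SSet.{u})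

/-- A map in the left-hand class lifts against the trivial fibration in a factorization of itself,
hence is a first factor of a monomorphism. -/
lemma ofHoms_overFamily_boundaryFamily_rlp_llp :
    (MorphismProperty.ofHoms (Over.overFamily boundaryFamily A)).rlp.llp =
      MorphismProperty.monomorphisms (Over A) := by
  ext X Y f
  refine ⟨fun h ↦ ?_, fun h Z T p hp ↦ ?_⟩
  · obtain ⟨Z, i, p, _, hp, fac⟩ := exists_mono_fac f.left
    let p' : Over.mk (p ≫ Y.hom) ⟶ Y := Over.homMk p rfl
    let i' : X ⟶ Over.mk (p ≫ Y.hom) := Over.homMk i (by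
      dsimp
      rw [reassoc_of% fac, Over.w])
    have : HasLiftingProperty f p' := h _ (by
      rwa [Over.rlp_ofHoms_overFamily_iff, ofHoms_boundaryFamily_rlp])
    have sq : CommSq i' f p' (𝟙 Y) := ⟨Over.OverMorphism.ext (fac.trans (Category.comp_id _).symm)⟩
    have : Mono i' := @Over.mono_of_mono_left _ _ _ _ _ i' ‹Mono i›
    exact mono_of_mono_fac sq.fac_left
  · have : Mono f := h
    rw [Over.rlp_ofHoms_overFamily_iff, ofHoms_boundaryFamily_rlp] at hp
    have : HasLiftingProperty f.left p.left := hp _ (inferInstanceAs (Mono f.left))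
    exact Over.hasLiftingProperty_of_left _ _

variable {ι : Type u} {K L : ι → SSet.{u}} {s : ∀ i, K i ⟶ L i}

lemma overCylinder_isAnodyne [∀ i, Mono (s i)]
    (hs : IsStableUnderBoundaryPushoutProduct (MorphismProperty.ofHoms s))
    (e : Fin 2) (he : MorphismProperty.ofHoms s Λ[1, e].ι) :
    (overCylinder A e).IsAnodyne (MorphismProperty.ofHoms (Over.overFamily s A)) where
  isLeftAdjoint := inferInstanceAs (Over.tensorRight Δ[1] A).IsLeftAdjoint
  le_monomorphisms := by
    rintro _ _ _ ⟨x⟩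
    exact @Over.mono_of_mono_left _ _ _ _ _ _ (inferInstanceAs (Mono (s x.1)))
  exists_lift {K L E B} k _ p hp a b β hab haβ hbβ := by
    rw [Over.rlp_ofHoms_overFamily_iff] at hp
    obtain ⟨γ, h₁, h₂, h₃⟩ := hs.exists_lift e he k.left p.left hp a.left b.left β.left
      (congr_arg CommaMorphism.left hab) (congr_arg CommaMorphism.left haβ)
      (congr_arg CommaMorphism.left hbβ)
    refine ⟨Over.homMk γ ?_, Over.OverMorphism.ext h₁, Over.OverMorphism.ext h₂,
      Over.OverMorphism.ext h₃⟩
    refine Eq.trans ?_ (Over.w β)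
    rw [← Over.w p, ← h₃]
    exact (Category.assoc _ _ _).symm
  exists_extension {K L W} k hk hW h f g hf hg := by
    rw [Over.rlp_ofHoms_overFamily_terminal_iff] at hW
    obtain ⟨x⟩ := hk
    obtain ⟨H, h₁, h₂, h₃, h₄⟩ := hs.exists_extension (Fin.rev_ne_self e)
      (s x.1) ⟨_⟩ W.hom hW h.left f.left g.left
      (fst (L x.1) Δ[1] ≫ x.2)
      (congr_arg CommaMorphism.left hf) (congr_arg CommaMorphism.left hg)
      ((Over.w h).trans (whiskerRight_fst_assoc _ _ _).symm)
      ((Over.w f).trans (cylinderEnd_fst_assoc _ _ _).symm)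
      ((Over.w g).trans (cylinderEnd_fst_assoc _ _ _).symm)
    exact ⟨Over.homMk H h₄, Over.OverMorphism.ext h₁, Over.OverMorphism.ext h₂,
      Over.OverMorphism.ext h₃⟩

end SSet

/-! ### Contravariant and covariant model structures -/

namespace SSet

open Limits

section

variable {ι : Type u} {K L : ι → SSet.{u}} {s : ∀ i, K i ⟶ L i} (A : SSet.{u})

attribute [local instance] Cardinal.fact_isRegular_aleph0 in
theorem exists_modelCategory_over [∀ i, Mono (s i)] [∀ i, (K i).Finite] [∀ i, (L i).Finite]
    (hs : IsStableUnderBoundaryPushoutProduct (MorphismProperty.ofHoms s))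
    (e : Fin 2) (he : MorphismProperty.ofHoms s Λ[1, e].ι) :
    ∃ (_ : ModelCategory (Over A)),
      cofibrations (Over A) = MorphismProperty.monomorphisms (Over A) ∧
      HomotopicalAlgebra.weakEquivalences (Over A) =
        (overCylinder A e).weakEquivalences (MorphismProperty.ofHoms (Over.overFamily s A)) ∧
      ∀ (X : Over A), IsFibrant X ↔ (MorphismProperty.ofHoms s).rlp X.hom := by
  have h (X : Over A) [X.left.Finite] : IsFinitelyPresentable.{u} X :=
    Over.isCardinalPresentable _ _
  have h₁ (x : Σ i, L i ⟶ A) : IsFinitelyPresentable.{u} (Over.mk (s x.1 ≫ x.2)) :=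
    have : (Over.mk (s x.1 ≫ x.2)).left.Finite := inferInstanceAs (K x.1).Finite
    h _
  have h₂ (x : Σ n : ULift.{u} ℕ, Δ[n.down] ⟶ A) :
      IsFinitelyPresentable.{u} (Over.mk (boundaryFamily x.1 ≫ x.2)) :=
    have : (Over.mk (boundaryFamily x.1 ≫ x.2)).left.Finite :=
      inferInstanceAs (∂Δ[x.1.down] : SSet.{u}).Finite
    h _
  have h₃ (x : Σ n : ULift.{u} ℕ, Δ[n.down] ⟶ A) : IsFinitelyPresentable.{u} (Over.mk x.2) :=
    have : (Over.mk x.2).left.Finite := inferInstanceAs (Δ[x.1.down] : SSet.{u}).Finite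
    h _
  have h₄ (x : Σ n : ULift.{u} ℕ, Δ[n.down] ⟶ A) : IsFinitelyPresentable.{u}
      ((overCylinder A e).cyl.obj (Over.mk (boundaryFamily x.1 ≫ x.2))) :=
    have : ((overCylinder A e).cyl.obj (Over.mk (boundaryFamily x.1 ≫ x.2))).left.Finite :=
      inferInstanceAs ((∂Δ[x.1.down] : SSet.{u}) ⊗ Δ[1]).Finite
    h _
  have h₅ (x : Σ n : ULift.{u} ℕ, Δ[n.down] ⟶ A) : IsFinitelyPresentable.{u}
      ((overCylinder A e).cyl.obj (Over.mk x.2)) :=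
    have : ((overCylinder A e).cyl.obj (Over.mk x.2)).left.Finite :=
      inferInstanceAs ((Δ[x.1.down] : SSet.{u}) ⊗ Δ[1]).Finite
    h _
  obtain ⟨M, hM₁, hM₂, hM₃⟩ := (overCylinder_isAnodyne A hs e he).exists_modelCategory
    (ofHoms_overFamily_boundaryFamily_rlp_llp A)
  refine ⟨M, hM₁, hM₂, fun X ↦ ?_⟩
  rw [hM₃, Over.rlp_ofHoms_overFamily_terminal_iff]

variable {A}

/-- For `e = 0` the cylinder has its ends exchanged, and symmetry of homotopy is needed, which holds
as `W` is injective. -/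
lemma homotopicOver_iff_of_isAnodyne {e : Fin 2} {J : MorphismProperty (Over A)}
    (hJ : (overCylinder A e).IsAnodyne J) {X W : Over A} (hW : J.rlp (terminal.from W))
    (f g : X ⟶ W) : HomotopicOver f g ↔ (overCylinder A e).Homotopic f g := by
  have h₁ : HomotopicOver f g ↔ ∃ h : (Over.tensorRight Δ[1] A).obj X ⟶ W,
      overCylinderEnd 0 X ≫ h = f ∧ overCylinderEnd 1 X ≫ h = g := by
    constructor
    · rintro ⟨h, h₀, h₁, h₂⟩
      exact ⟨Over.homMk h h₂, Over.OverMorphism.ext h₀, Over.OverMorphism.ext h₁⟩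
    · rintro ⟨h, h₀, h₁⟩
      exact ⟨h.left, congr_arg CommaMorphism.left h₀, congr_arg CommaMorphism.left h₁, Over.w h⟩
  rw [h₁]
  fin_cases e
  · exact ⟨fun ⟨h, h₀, h₁⟩ ↦ hJ.symm hW ⟨h, h₁, h₀⟩, fun H ↦
      have ⟨h, h₀, h₁⟩ := hJ.symm hW H
      ⟨h, h₁, h₀⟩⟩
  · rfl

lemma HomotopyClassesOver.mk_eq_mk_iff {e : Fin 2} {J : MorphismProperty (Over A)}
    (hJ : (overCylinder A e).IsAnodyne J) {X W : Over A} (hW : J.rlp (terminal.from W))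
    (f g : X ⟶ W) :
    (Quot.mk _ f : HomotopyClassesOver X W) = Quot.mk _ g ↔
      (overCylinder A e).Homotopic f g := by
  rw [← homotopicOver_iff_of_isAnodyne hJ hW]
  refine ⟨fun h ↦ ?_, Quot.sound⟩
  have : _root_.Equivalence (HomotopicOver (X := X) (W := W)) := by
    have h : HomotopicOver (X := X) (W := W) = (overCylinder A e).Homotopic := by
      ext f g
      exact homotopicOver_iff_of_isAnodyne hJ hW f g
    rw [h]
    exact ⟨.refl, hJ.symm hW, hJ.trans hW⟩
  exact this.eqvGen_iff.1 (Quot.eqvGen_exact h)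

lemma weakEquivalences_overCylinder_iff {e : Fin 2} [∀ i, Mono (s i)]
    (hJ : (overCylinder A e).IsAnodyne (MorphismProperty.ofHoms (Over.overFamily s A)))
    {X Y : Over A} (f : X ⟶ Y) :
    (overCylinder A e).weakEquivalences (MorphismProperty.ofHoms (Over.overFamily s A)) f ↔
      ∀ W : Over A, (MorphismProperty.ofHoms s).rlp W.hom →
        Function.Bijective (HomotopyClassesOver.precomp f W) := by
  refine forall_congr' fun W ↦ ?_
  rw [← Over.rlp_ofHoms_overFamily_terminal_iff]
  refine forall_congr' fun hW ↦ ?_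
  rw [Function.Bijective, and_comm]
  refine and_congr ⟨?_, ?_⟩ ⟨?_, ?_⟩
  · rintro h ⟨g⟩ ⟨g'⟩ hg
    exact (HomotopyClassesOver.mk_eq_mk_iff hJ hW _ _).2
      (h _ _ ((HomotopyClassesOver.mk_eq_mk_iff hJ hW _ _).1 hg))
  · intro h g g' hg
    exact (HomotopyClassesOver.mk_eq_mk_iff hJ hW _ _).1
      (h ((HomotopyClassesOver.mk_eq_mk_iff hJ hW _ _).2 hg))
  · rintro h ⟨g⟩
    obtain ⟨g', hg'⟩ := h g
    exact ⟨Quot.mk _ g', (HomotopyClassesOver.mk_eq_mk_iff hJ hW _ _).2 hg'⟩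
  · intro h g
    obtain ⟨⟨g'⟩, hg'⟩ := h (Quot.mk _ g)
    exact ⟨g', (HomotopyClassesOver.mk_eq_mk_iff hJ hW _ _).1 hg'⟩

namespace HasMonoCofibrationsAndFibrantObjects

variable {P : MorphismProperty SSet.{u}}

lemma cofibrations_eq {M : ModelCategory (Over A)}
    (h : HasMonoCofibrationsAndFibrantObjects A P M) :
    cofibrations (Over A) = MorphismProperty.monomorphisms (Over A) := by
  ext X Y f
  rw [← HomotopicalAlgebra.cofibration_iff, h.cofibration_iff]
  exact (Over.mono_iff_mono_left f).symm

lemma isCofibrant {M : ModelCategory (Over A)} (h : HasMonoCofibrationsAndFibrantObjects A P M)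
    (X : Over A) : IsCofibrant X := by
  rw [isCofibrant_iff, HomotopicalAlgebra.cofibration_iff, h.cofibrations_eq]
  exact inferInstanceAs (Mono (initial.to X))

lemma ext {M₁ M₂ : ModelCategory (Over A)} (h₁ : HasMonoCofibrationsAndFibrantObjects A P M₁)
    (h₂ : HasMonoCofibrationsAndFibrantObjects A P M₂) : M₁ = M₂ :=
  ModelCategory.ext_of_isCofibrant M₁ M₂ (h₁.cofibrations_eq.trans h₂.cofibrations_eq.symm)
    (fun X ↦ (h₁.isFibrant_iff X).trans (h₂.isFibrant_iff X).symm) h₁.isCofibrant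

end HasMonoCofibrationsAndFibrantObjects

theorem existsUnique_modelCategory_over [∀ i, Mono (s i)] [∀ i, (K i).Finite]
    [∀ i, (L i).Finite]
    (hs : IsStableUnderBoundaryPushoutProduct (MorphismProperty.ofHoms s))
    (e : Fin 2) (he : MorphismProperty.ofHoms s Λ[1, e].ι) :
    (∃! M : ModelCategory (Over A),
      HasMonoCofibrationsAndFibrantObjects A (MorphismProperty.ofHoms s).rlp M) ∧
    ∀ M : ModelCategory (Over A),
      HasMonoCofibrationsAndFibrantObjects A (MorphismProperty.ofHoms s).rlp M →
        ∀ {X Y : Over A} (f : X ⟶ Y), WeakEquivalence f ↔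
          ∀ W : Over A, (MorphismProperty.ofHoms s).rlp W.hom →
            Function.Bijective (HomotopyClassesOver.precomp f W) := by
  obtain ⟨M, hM₁, hM₂, hM₃⟩ := exists_modelCategory_over A hs e he
  have hM : HasMonoCofibrationsAndFibrantObjects A (MorphismProperty.ofHoms s).rlp M :=
    { cofibration_iff i := by
        rw [cofibration_iff, hM₁]
        exact Over.mono_iff_mono_left i
      isFibrant_iff := hM₃ }
  refine ⟨⟨M, hM, fun M' hM' ↦ hM'.ext hM⟩, fun M' hM' X Y f ↦ ?_⟩
  obtain rfl := hM'.ext hM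
  rw [weakEquivalence_iff, hM₂]
  exact weakEquivalences_overCylinder_iff (overCylinder_isAnodyne A hs e he) f

end

/-- The horn inclusions in `rightHornInclusions`, indexed by a type in the universe `u`. -/
noncomputable def rightHornFamily (x : ULift.{u} (Σ n : ℕ, { k : Fin (n + 2) // 0 < k })) :
    (Λ[x.down.1 + 1, x.down.2.1] : SSet.{u}) ⟶ Δ[x.down.1 + 1] :=
  Λ[x.down.1 + 1, x.down.2.1].ι

lemma ofHoms_rightHornFamily :
    MorphismProperty.ofHoms rightHornFamily.{u} = rightHornInclusions := by
  ext X Y f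
  constructor
  · rintro ⟨⟨n, k, hk⟩⟩
    exact ⟨k, hk⟩
  · rintro ⟨k, hk⟩
    exact .mk (f := rightHornFamily) (ULift.up ⟨_, k, hk⟩)

/-- The horn inclusions in `leftHornInclusions`, indexed by a type in the universe `u`. -/
noncomputable def leftHornFamily
    (x : ULift.{u} (Σ n : ℕ, { k : Fin (n + 2) // k < Fin.last (n + 1) })) :
    (Λ[x.down.1 + 1, x.down.2.1] : SSet.{u}) ⟶ Δ[x.down.1 + 1] :=
  Λ[x.down.1 + 1, x.down.2.1].ι

lemma ofHoms_leftHornFamily :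
    MorphismProperty.ofHoms leftHornFamily.{u} = leftHornInclusions := by
  ext X Y f
  constructor
  · rintro ⟨⟨n, k, hk⟩⟩
    exact ⟨k, hk⟩
  · rintro ⟨k, hk⟩
    exact .mk (f := leftHornFamily) (ULift.up ⟨_, k, hk⟩)

instance (x) : Mono (rightHornFamily.{u} x) := inferInstanceAs (Mono Λ[_, _].ι)

instance (x) : Mono (leftHornFamily.{u} x) := inferInstanceAs (Mono Λ[_, _].ι)

end SSet

theorem mainTheorem5 (A : SSet.{u}) :
    ((∃! M : ModelCategory (Over A),
        SSet.HasMonoCofibrationsAndFibrantObjects A SSet.rightFibrations M) ∧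
      ∀ M : ModelCategory (Over A),
        SSet.HasMonoCofibrationsAndFibrantObjects A SSet.rightFibrations M →
          ∀ {X Y : Over A} (f : X ⟶ Y),
            WeakEquivalence f ↔ SSet.IsContravariantEquivalence f) ∧
    ((∃! M : ModelCategory (Over A),
        SSet.HasMonoCofibrationsAndFibrantObjects A SSet.leftFibrations M) ∧
      ∀ M : ModelCategory (Over A),
        SSet.HasMonoCofibrationsAndFibrantObjects A SSet.leftFibrations M →
          ∀ {X Y : Over A} (f : X ⟶ Y),
            WeakEquivalence f ↔ SSet.IsCovariantEquivalence f) := by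
  -- The end is the vertex 1, since `Λ[1, 1]` is a right horn; in the covariant case it is 0, since
  -- `Λ[1, 0]` is a left horn.
  have h₁ := SSet.existsUnique_modelCategory_over (A := A) (s := SSet.rightHornFamily)
    (by
      rw [SSet.ofHoms_rightHornFamily]
      exact SSet.rightHornInclusions_isStableUnderBoundaryPushoutProduct) 1
    (by
      rw [SSet.ofHoms_rightHornFamily]
      exact ⟨_, Fin.zero_lt_one⟩)
  have h₂ := SSet.existsUnique_modelCategory_over (A := A) (s := SSet.leftHornFamily)
    (by
      rw [SSet.ofHoms_leftHornFamily]
      exact SSet.leftHornInclusions_isStableUnderBoundaryPushoutProduct) 0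
    (by
      rw [SSet.ofHoms_leftHornFamily]
      exact ⟨_, Fin.zero_lt_one⟩)
  rw [SSet.ofHoms_rightHornFamily] at h₁
  rw [SSet.ofHoms_leftHornFamily] at h₂
  exact ⟨h₁, h₂⟩
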